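/- All graphs are finite, with non-empty vertex set. A network is a connected directed acyclic graph $N$ in which every vertex of indegree $0$ has outdegree at least $2$, every vertex of outdegree $0$ has indegree $1$, and no vertex has both indegree $1$ and outdegree $1$; its leaves are the vertices of outdegree $0$. It is arboreal if its underlying undirected graph is a tree. A labelled arboreal network $(N,t)$ is an arboreal network $N$ with a map $t$ from the set of vertices of outdegree at least $2$ to $\{0,1\}$. A vertex $u$ is an ancestor of $v$ if there is a directed path, possibly of length $0$, from $u$ to $v$. A least common ancestor of two leaves is a common ancestor none of whose children is a common ancestor; in an arboreal network, two distinct leaves $x,y$ with a common ancestor have exactly one, written $\operatorname{lca}_N(x,y)$, and it has outdegree at least $2$. The shared ancestry graph $\mathcal A(N)$ has the leaves of $N$ as vertices, two distinct leaves being adjacent if and only if they have a common ancestor. The graph $\mathcal C(N,t)$ has the leaves of $N$ as vertices, two distinct leaves $x,y$ being adjacent if and only if they have a common ancestor and $t(\operatorname{lca}_N(x,y))=1$. We say that $(N,t)$ explains $G$ if $G=\mathcal C(N,t)$ (so the vertex set of $G$ is the leaf set of $N$), and that $G$ is arboreal-explainable if some labelled arboreal network explains it. A graph $H$ is Ptolemaic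 if $d_H(x,z)\,d_H(y,t)\le d_H(x,y)\,d_H(z,t)+d_H(x,t)\,d_H(y,z)$ for all distinct, pairwise connected vertices $x,y,z,t$ of $H$, where $d_H$ is the shortest-path distance. For a graph $G$ and a supergraph $G^*$ of $G$ on the same vertex set, an asymmetric diamond of $(G,G^*)$ is an ordered quadruple $(x,y,z,u)$ of distinct vertices such that any two of them are adjacent in $G^*$ except $z$ and $u$, which are not; $x$ and $z$ are adjacent in $G$; and $y$ and $z$ are not adjacent in $G$. **Theorem.** Let $G$ be a connected arboreal-explainable graph with vertex set $X$, and let $G^*$ be a supergraph of $G$ with vertex set $X$. Then there exists a labelled arboreal network $(N,t)$ that explains $G$ and satisfies $\mathcal A(N)=G^*$ if and only if the following three conditions hold: (E1) $G^*$ is connected and Ptolemaic. (E2) There are no four vertices in $X$ that induce a $P_4$ (a path on four vertices) in $G$ and a clique in $G^*$. (E3) $(G,G^*)$ has no asymmetric diamond. -/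

import Mathlib

universe u

namespace ArborealNet

variable {V : Type u}

/-- The number of parents of a vertex. -/
noncomputable def indegree (D : Digraph V) (v : V) : ℕ := {p : V | D.Adj p v}.ncard

/-- The number of children of a vertex. -/
noncomputable def outdegree (D : Digraph V) (v : V) : ℕ := {c : V | D.Adj v c}.ncard

/-- There is a directed path (possibly of length zero) from `a` to `v`. -/
def IsAncestor (D : Digraph V) (a v : V) : Prop := Relation.ReflTransGen D.Adj a v

/-- Some vertex is an ancestor of both `v` and `w`. -/
def ShareAncestor (D : Digraph V) (v w : V) : Prop :=
  ∃ a, IsAncestor D a v ∧ IsAncestor D a w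

/-- `a` is a least common ancestor of `x` and `y`: it is an ancestor of both, and none of its
children is an ancestor of both. -/
def IsLCA (D : Digraph V) (a x y : V) : Prop :=
  (IsAncestor D a x ∧ IsAncestor D a y) ∧
    ∀ c, D.Adj a c → ¬ (IsAncestor D c x ∧ IsAncestor D c y)

/-- No directed cycle (in particular no loop and no pair of opposite arcs). -/
def IsAcyclic (D : Digraph V) : Prop := ∀ v, ¬ Relation.TransGen D.Adj v v

/-- A network: a nonempty finite connected directed acyclic graph, in which every vertex of
indegree `0` has outdegree at least `2`, every vertex of outdegree `0` has indegree `1`, and no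
vertex has both indegree `1` and outdegree `1`. -/
structure IsNetwork (D : Digraph V) : Prop where
  finite : Finite V
  connected : D.toSimpleGraphInclusive.Connected
  acyclic : IsAcyclic D
  two_le_outdegree_of_root : ∀ v, indegree D v = 0 → 2 ≤ outdegree D v
  indegree_of_leaf : ∀ v, outdegree D v = 0 → indegree D v = 1
  no_subdivision : ∀ v, ¬ (indegree D v = 1 ∧ outdegree D v = 1)

/-- An arboreal network: a network whose underlying undirected graph is a tree. -/
structure IsArborealNetwork (D : Digraph V) : Prop extends IsNetwork D where
  isTree : D.toSimpleGraphInclusive.IsTree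

/-- The set `L(N)` of leaves, as a type. -/
abbrev Leaf (D : Digraph V) : Type u := {v : V // outdegree D v = 0}

/-- The set `V*(N)` of vertices of outdegree at least `2`, as a type. -/
abbrev Branching (D : Digraph V) : Type u := {v : V // 2 ≤ outdegree D v}

/-- A labelled arboreal network `(N, t)` with vertex type `V`. -/
structure LabelledArborealNetwork (V : Type u) where
  /-- The network `N`. -/
  net : Digraph V
  arboreal : IsArborealNetwork net
  /-- The labelling `t : V*(N) → {0, 1}`. -/
  label : Branching net → Fin 2

/-- The shared ancestry graph `A(N)`, with the leaves of `N` as vertices. -/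
def sharedAncestryGraph (D : Digraph V) : SimpleGraph (Leaf D) where
  Adj x y := x ≠ y ∧ ShareAncestor D x.1 y.1
  symm := ⟨fun _ _ h => ⟨h.1.symm, let ⟨a, hx, hy⟩ := h.2; ⟨a, hy, hx⟩⟩⟩
  loopless := ⟨fun _ h => h.1 rfl⟩

/-- The graph `C(N, t)`, with the leaves of `N` as vertices: distinct leaves are adjacent when
they share an ancestor and their least common ancestor has label `1`. (In an arboreal network two
distinct leaves that share an ancestor have exactly one least common ancestor, and it has
outdegree at least `2`.) -/
def LabelledArborealNetwork.explainedGraph (N : LabelledArborealNetwork V) :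
    SimpleGraph (Leaf N.net) where
  Adj x y := x ≠ y ∧ ShareAncestor N.net x.1 y.1 ∧
    ∃ a : Branching N.net, IsLCA N.net a.1 x.1 y.1 ∧ N.label a = 1
  symm := ⟨fun _ _ h => ⟨h.1.symm, let ⟨a, hx, hy⟩ := h.2.1; ⟨a, hy, hx⟩,
    let ⟨a, ha, ht⟩ := h.2.2; ⟨a, ⟨ha.1.symm, fun c hc h' => ha.2 c hc h'.symm⟩, ht⟩⟩⟩
  loopless := ⟨fun _ h => h.1 rfl⟩

/-- `(N, t)` explains the graph `G` on `X`, where the leaf set of `N` is identified with `X`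
through `e`. -/
def LabelledArborealNetwork.Explains {X : Type u} (N : LabelledArborealNetwork V)
    (e : X ≃ Leaf N.net) (G : SimpleGraph X) : Prop :=
  N.explainedGraph.comap e = G

/-- Some labelled arboreal network with leaf set `X` explains `G`. -/
def ArborealExplainable {X : Type u} (G : SimpleGraph X) : Prop :=
  ∃ (V : Type u) (N : LabelledArborealNetwork V) (e : X ≃ Leaf N.net), N.Explains e G

/-- Ptolemy's inequality holds for all distinct, pairwise connected `x, y, z, t`. -/
def IsPtolemaic {X : Type u} (G : SimpleGraph X) : Prop :=
  ∀ x y z t : X, [x, y, z, t].Pairwise (fun a b => a ≠ b ∧ G.Reachable a b) →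
    G.dist x z * G.dist y t ≤ G.dist x y * G.dist z t + G.dist x t * G.dist y z

/-- `(x, y, z, w)` is an asymmetric diamond of `(G, Gs)`. -/
def IsAsymmetricDiamond {X : Type u} (G Gs : SimpleGraph X) (x y z w : X) : Prop :=
  [x, y, z, w].Nodup ∧
  (Gs.Adj x y ∧ Gs.Adj x z ∧ Gs.Adj x w ∧ Gs.Adj y z ∧ Gs.Adj y w ∧ ¬ Gs.Adj z w) ∧
  G.Adj x z ∧ ¬ G.Adj y z

end ArborealNet

/-!
Write `Gs` for the supergraph. Both directions rest on two ways of building a pair `(G, Gs)` that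
correspond to two ways of building a network.

* *Joint twins* `x`, `v`: adjacent twins of `Gs` that are also (true or false) twins of `G`. In a
  network, they are the two leaves of a cherry.
* *A cut vertex* `s` of `Gs`. In a network, `s` is a leaf below a vertex with several parents, and
  separating these parents splits the network into smaller ones that share only the leaf `s`.

The conditions (E1), (E2), (E3), bundled as `Good`, survive both constructions
(`Good.of_jointTwins`, `Good.of_isCut`). For Ptolemy's inequality this is arithmetic: twins have
the same distances to all other vertices, and distances add up across a cut vertex.

From a network to the conditions: the two graphs are defined on all vertices of an oriented forest,
not only on the leaves (`shareGraph`, `lcaGraph`). A sink with a single parent is a joint twin of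
that parent, and a sink with several parents is a cut vertex, so induction on the number of
vertices applies (`good_lcaGraph_shareGraph`). The conditions then pass to the leaves, because
Ptolemy's inequality makes `Gs` distance-hereditary: connected induced subgraphs are isometric
(`dist_comap_eq`, `Good.comap`).

From the conditions to a network: a pair with at least two vertices has joint twins or a cut vertex
(`Good.jointTwins_or_isCut`). If `Gs` is complete, then `G` is `P₄`-free by (E2), and a `P₄`-free
graph has twins (`NoP4On.exists_twins`). Otherwise let `u`, `w` be vertices at distance two with
the fewest common neighbours, and let `K` be the set of these. As `Gs` has no induced four-cycle and
no gem, the vertices of `K` are pairwise adjacent twins of `Gs`, and (E3) makes `K` a module of `G`.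
If `K` has at least two elements, (E2) gives joint twins inside it; if `K` is a single vertex, this
vertex separates `u` from `w`, because `Gs` is distance-hereditary. The network is then built by
induction, from cherries (`Represents.exists_cherry`) and gluing (`Represents.exists_glue`). That
the underlying graph stays a tree follows by counting arcs (`isTree_iff_sum_indegree`).

Explainability of `G` only serves to exclude the graph with a single vertex, as every arboreal
network has at least two leaves (`IsArborealNetwork.nontrivial_leaf`).
-/

namespace ArborealNet

open SimpleGraph

/-! ### Ptolemaic graphs and the conditions in elementwise form -/

section Ptolemaic

variable {X Y : Type*} {G Gs : SimpleGraph X}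

/-- The conditions (E1), (E2), (E3) on a graph `G` and a supergraph `Gs`, in elementwise form.
Ptolemy's inequality is required for all quadruples: in a connected graph it is automatic when
two of the four vertices coincide. In `noP4` the distinctness of `a`, `b`, `c`, `d` follows from the
adjacencies. -/
structure Good (G Gs : SimpleGraph X) : Prop where
  le : G ≤ Gs
  conn : Gs.Connected
  ptolemy : ∀ x y z t, Gs.dist x z * Gs.dist y t ≤
    Gs.dist x y * Gs.dist z t + Gs.dist x t * Gs.dist y z
  noP4 : ∀ a b c d, G.Adj a b → G.Adj b c → G.Adj c d → ¬ G.Adj a c → ¬ G.Adj a d → ¬ G.Adj b d →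
    Gs.Adj a c → Gs.Adj a d → Gs.Adj b d → False
  noDiamond : ∀ x y z w, Gs.Adj x y → Gs.Adj x z → Gs.Adj x w → Gs.Adj y z → Gs.Adj y w →
    z ≠ w → ¬ Gs.Adj z w → G.Adj x z → G.Adj y z

/-- A map that sends edges to edges or collapses them does not increase distances. -/
lemma dist_map_le {H : SimpleGraph Y} (f : X → Y)
    (hf : ∀ a b, Gs.Adj a b → f a = f b ∨ H.Adj (f a) (f b)) {a b : X} (hab : Gs.Reachable a b) :
    H.Reachable (f a) (f b) ∧ H.dist (f a) (f b) ≤ Gs.dist a b := by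
  have key : ∀ {a b : X} (p : Gs.Walk a b), ∃ q : H.Walk (f a) (f b), q.length ≤ p.length := by
    intro a b p
    induction p with
    | nil => exact ⟨.nil, le_rfl⟩
    | cons h p ih =>
      obtain ⟨q, hq⟩ := ih
      rcases hf _ _ h with h' | h'
      · exact ⟨q.copy h'.symm rfl, by simp; omega⟩
      · exact ⟨.cons h' q, by simp; omega⟩
  obtain ⟨p, hp⟩ := hab.exists_walk_length_eq_dist
  obtain ⟨q, hq⟩ := key p
  exact ⟨⟨q⟩, (dist_le q).trans (hq.trans hp.le)⟩

/-- A subgraph onto which the whole graph retracts is connected and isometrically embedded. -/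
lemma retract_subset (hc : Gs.Connected) (A : Set X) (r : X → X) (hr : ∀ a, r a ∈ A)
    (hrA : ∀ a ∈ A, r a = a) (hadj : ∀ a b, Gs.Adj a b → r a = r b ∨ Gs.Adj (r a) (r b)) :
    (Gs.comap (Subtype.val : A → X)).Connected ∧
      ∀ a b : A, (Gs.comap (Subtype.val : A → X)).dist a b = Gs.dist a.1 b.1 := by
  have h1 : ∀ a b : A, (Gs.comap (Subtype.val : A → X)).Reachable a b ∧
      (Gs.comap (Subtype.val : A → X)).dist a b ≤ Gs.dist a.1 b.1 := by
    intro a b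
    have := dist_map_le (H := Gs.comap (Subtype.val : A → X)) (fun x => (⟨r x, hr x⟩ : A))
      (fun a b h => (hadj a b h).imp (fun h => Subtype.ext h) id) (hc.preconnected a.1 b.1)
    simpa [hrA _ a.2, hrA _ b.2] using this
  obtain ⟨x⟩ := hc.nonempty
  refine ⟨(connected_iff _).2 ⟨fun a b => (h1 a b).1, ⟨⟨r x, hr x⟩⟩⟩, fun a b => ?_⟩
  exact le_antisymm (h1 a b).2
    (dist_map_le (Gs := Gs.comap (Subtype.val : A → X)) (H := Gs) Subtype.val
      (fun _ _ h => Or.inr h) (h1 a b).1).2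

lemma exists_adj_dist_succ {a b : X} {k : ℕ} (h : Gs.dist a b = k + 1) :
    ∃ c, Gs.Adj a c ∧ Gs.Reachable c b ∧ Gs.dist c b = k := by
  obtain ⟨p, hp⟩ := exists_walk_of_dist_ne_zero (G := Gs) (u := a) (v := b) (by omega)
  cases p with
  | nil => rw [h] at hp; simp at hp
  | @cons _ c _ hac q =>
    refine ⟨c, hac, ⟨q⟩, ?_⟩
    have h1 := dist_le q
    have h2 := hac.reachable.dist_triangle_left (G := Gs) b
    rw [dist_eq_one_iff_adj.2 hac] at h2
    simp at hp
    omega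

/-- Graphs satisfying Ptolemy's inequality are distance-hereditary: their connected induced
subgraphs are isometric. -/
lemma dist_comap_eq (hc : Gs.Connected)
    (hp : ∀ x y z t, Gs.dist x z * Gs.dist y t ≤
      Gs.dist x y * Gs.dist z t + Gs.dist x t * Gs.dist y z)
    {f : Y → X} (hf : f.Injective) :
    ∀ {a b : Y}, (Gs.comap f).Reachable a b → (Gs.comap f).dist a b = Gs.dist (f a) (f b) := by
  have key : ∀ (k : ℕ) (a b : Y), (Gs.comap f).Reachable a b → (Gs.comap f).dist a b = k →
      Gs.dist (f a) (f b) = k := by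
    intro k
    induction k using Nat.strong_induction_on with
    | _ k ih =>
      intro a b hr hk
      have hle : Gs.dist (f a) (f b) ≤ k :=
        hk ▸ (dist_map_le (H := Gs) f (fun _ _ h => Or.inr h) hr).2
      match k, hk with
      | 0, hk =>
        rw [hr.dist_eq_zero_iff] at hk
        simp [hk]
      | 1, hk =>
        rw [dist_eq_one_iff_adj] at hk ⊢
        exact hk
      | 2, hk =>
        have hne : a ≠ b := by rintro rfl; simp at hk
        have hna : ¬ (Gs.comap f).Adj a b := by
          intro h; rw [dist_eq_one_iff_adj.2 h] at hk; omega
        have := hc.one_lt_dist_of_ne_of_not_adj (hf.ne hne) hna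
        omega
      | m + 3, hk =>
        obtain ⟨a', haa, hr1, hd1⟩ := exists_adj_dist_succ hk
        obtain ⟨b', hbb, hr2, hd2⟩ := exists_adj_dist_succ (a := b) (b := a') (k := m + 1)
          (by rw [dist_comm]; exact hd1)
        have hr3 : (Gs.comap f).Reachable a b' := hr.trans hbb.reachable
        have hd3 : (Gs.comap f).dist a b' = m + 2 := by
          have h1 := haa.reachable.dist_triangle_left (G := Gs.comap f) b'
          have h2 := hr3.dist_triangle_left (G := Gs.comap f) b
          rw [dist_eq_one_iff_adj.2 haa, dist_comm, dist_comm (u := a')] at h1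
          rw [dist_eq_one_iff_adj.2 hbb.symm] at h2
          rw [dist_comm] at h1
          omega
        have e1 := ih (m + 2) (by omega) _ _ hr3 hd3
        have e2 := ih (m + 2) (by omega) _ _ hr1 hd1
        have e3 := ih (m + 1) (by omega) _ _ hr2.symm (by rw [dist_comm]; exact hd2)
        have e4 : Gs.dist (f a) (f a') = 1 := dist_eq_one_iff_adj.2 haa
        have e5 : Gs.dist (f b') (f b) = 1 := dist_eq_one_iff_adj.2 hbb.symm
        have := hp (f a) (f a') (f b') (f b)
        rw [e1, e2, e3, e4, e5] at this
        nlinarith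
  intro a b hr
  exact (key _ a b hr rfl).symm

/-- The conditions pass to connected induced subgraphs. -/
lemma Good.comap (h : Good G Gs) {f : Y → X} (hf : f.Injective) (hc : (Gs.comap f).Connected) :
    Good (G.comap f) (Gs.comap f) where
  le := fun _ _ hab => h.le hab
  conn := hc
  ptolemy x y z t := by
    simp only [dist_comap_eq h.conn h.ptolemy hf (hc.preconnected _ _)]
    exact h.ptolemy _ _ _ _
  noP4 a b c d := h.noP4 _ _ _ _
  noDiamond x y z w h1 h2 h3 h4 h5 hne := h.noDiamond _ _ _ _ h1 h2 h3 h4 h5 (hf.ne hne)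

/-- The three instances of Ptolemy's inequality for four points. -/
def Ptolemy4 (d : X → X → ℕ) (x y z t : X) : Prop :=
  d x z * d y t ≤ d x y * d z t + d x t * d y z ∧
  d x y * d z t ≤ d x z * d y t + d x t * d y z ∧
  d x t * d y z ≤ d x z * d y t + d x y * d z t

lemma Ptolemy4.swap₁₂ {d : X → X → ℕ} (hd : ∀ a b, d a b = d b a) {x y z t : X}
    (h : Ptolemy4 d x y z t) : Ptolemy4 d y x z t := by
  obtain ⟨h1, h2, h3⟩ := h
  simp only [Ptolemy4, hd y x]
  refine ⟨?_, ?_, ?_⟩ <;> linarith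

lemma Ptolemy4.swap₂₃ {d : X → X → ℕ} (hd : ∀ a b, d a b = d b a) {x y z t : X}
    (h : Ptolemy4 d x y z t) : Ptolemy4 d x z y t := by
  obtain ⟨h1, h2, h3⟩ := h
  simp only [Ptolemy4, hd z y]
  refine ⟨?_, ?_, ?_⟩ <;> linarith

lemma Ptolemy4.swap₃₄ {d : X → X → ℕ} (hd : ∀ a b, d a b = d b a) {x y z t : X}
    (h : Ptolemy4 d x y z t) : Ptolemy4 d x y t z := by
  obtain ⟨h1, h2, h3⟩ := h
  simp only [Ptolemy4, hd t z]
  refine ⟨?_, ?_, ?_⟩ <;> linarith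

lemma ptolemy4_of_forall {d : X → X → ℕ} (hd : ∀ a b, d a b = d b a)
    (h : ∀ x y z t, d x z * d y t ≤ d x y * d z t + d x t * d y z) (x y z t : X) :
    Ptolemy4 d x y z t := by
  refine ⟨h x y z t, ?_, ?_⟩
  · have := h x z y t
    rwa [hd z y] at this
  · have := h x y t z
    rw [hd t z] at this
    have h2 := h x z t y
    rw [hd z y, hd t y] at h2
    linarith

end Ptolemaic

/-! ### Inserting a joint twin -/

section Composition

variable {X : Type*} {G Gs : SimpleGraph X}

lemma ptolemy4_self {d : X → X → ℕ} (h0 : ∀ a, d a a = 0)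
    (x y t : X) : Ptolemy4 d x x y t := by
  simp only [Ptolemy4, h0]
  refine ⟨?_, ?_, ?_⟩ <;> nlinarith

/-- `x` and `v` are adjacent twins in `Gs` and (true or false) twins in `G`. -/
structure JointTwins (G Gs : SimpleGraph X) (x v : X) : Prop where
  adj : Gs.Adj x v
  iff₁ : ∀ z, z ≠ x → z ≠ v → (Gs.Adj x z ↔ Gs.Adj v z)
  iff₂ : ∀ z, z ≠ x → z ≠ v → (G.Adj x z ↔ G.Adj v z)

lemma JointTwins.symm {x v : X} (h : JointTwins G Gs x v) : JointTwins G Gs v x where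
  adj := h.adj.symm
  iff₁ z h1 h2 := (h.iff₁ z h2 h1).symm
  iff₂ z h1 h2 := (h.iff₂ z h2 h1).symm

open Classical in
/-- The map that replaces `v` by `x`. -/
noncomputable def fold (x v : X) : X → X := fun z => if z = v then x else z

@[simp] lemma fold_self (x v : X) : fold x v v = x := if_pos rfl

lemma fold_of_ne {x v z : X} (h : z ≠ v) : fold x v z = z := if_neg h

lemma fold_ne {x v : X} (h : x ≠ v) (z : X) : fold x v z ≠ v := by
  unfold fold; split_ifs with h' <;> assumption

lemma JointTwins.fold_adj {x v : X} (h : JointTwins G Gs x v) {a b : X} (hab : Gs.Adj a b) :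
    fold x v a = fold x v b ∨ Gs.Adj (fold x v a) (fold x v b) := by
  have h1 := h.iff₁
  by_cases ha : a = v <;> by_cases hb : b = v
  · simp [ha, hb]
  · subst ha
    rw [fold_self, fold_of_ne hb]
    by_cases hx : b = x
    · exact Or.inl hx.symm
    · exact Or.inr ((h1 _ hx hb).2 hab)
  · subst hb
    rw [fold_self, fold_of_ne ha]
    by_cases hx : a = x
    · exact Or.inl hx
    · exact Or.inr ((h1 _ hx ha).2 hab.symm).symm
  · rw [fold_of_ne ha, fold_of_ne hb]; exact Or.inr hab

lemma JointTwins.connected_compl {x v : X} (h : JointTwins G Gs x v) (hc : Gs.Connected) :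
    (Gs.comap (Subtype.val : {z | z ≠ v} → X)).Connected ∧
      ∀ a b : {z | z ≠ v}, (Gs.comap (Subtype.val : {z | z ≠ v} → X)).dist a b =
        Gs.dist a.1 b.1 :=
  retract_subset hc {z | z ≠ v} (fold x v) (fold_ne h.adj.ne)
    (fun _ ha => fold_of_ne ha) (fun _ _ hab => h.fold_adj hab)

lemma JointTwins.dist_eq {x v : X} (h : JointTwins G Gs x v) (hc : Gs.Connected) {z : X}
    (hx : z ≠ x) (hv : z ≠ v) : Gs.dist v z = Gs.dist x z := by
  apply le_antisymm
  · have := (dist_map_le (fold v x) (fun _ _ hab => h.symm.fold_adj hab)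
      (hc.preconnected x z)).2
    rwa [fold_self, fold_of_ne hx] at this
  · have := (dist_map_le (fold x v) (fun _ _ hab => h.fold_adj hab) (hc.preconnected v z)).2
    rwa [fold_self, fold_of_ne hv] at this

lemma JointTwins.ptolemy {x v : X} (h : JointTwins G Gs x v) (hc : Gs.Connected)
    (hp : ∀ a b c e, a ≠ v → b ≠ v → c ≠ v → e ≠ v → Ptolemy4 Gs.dist a b c e) (a b c e : X) :
    Ptolemy4 Gs.dist a b c e := by
  have hd : ∀ a b, Gs.dist a b = Gs.dist b a := fun _ _ => dist_comm
  have h0 : ∀ a, Gs.dist a a = 0 := fun _ => dist_self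
  have hxv : Gs.dist x v = 1 := dist_eq_one_iff_adj.2 h.adj
  -- four points that include both twins
  have T : ∀ z t, Ptolemy4 Gs.dist x v z t := by
    intro z t
    by_cases hzx : z = x
    · subst hzx
      exact (ptolemy4_self h0 z v t).swap₂₃ hd
    by_cases hzv : z = v
    · subst hzv
      exact ((ptolemy4_self h0 z x t).swap₂₃ hd).swap₁₂ hd
    by_cases htx : t = x
    · subst htx
      exact ((ptolemy4_self h0 t v z).swap₂₃ hd).swap₃₄ hd
    by_cases htv : t = v
    · subst htv
      exact (((ptolemy4_self h0 t x z).swap₂₃ hd).swap₁₂ hd).swap₃₄ hd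
    have e1 := h.dist_eq hc hzx hzv
    have e2 := h.dist_eq hc htx htv
    have tri : Gs.dist z t ≤ Gs.dist z x + Gs.dist x t := hc.dist_triangle
    rw [hd z x] at tri
    have p1 := hc.pos_dist_of_ne (Ne.symm hzx)
    have p2 := hc.pos_dist_of_ne (Ne.symm htx)
    simp only [Ptolemy4, e1, e2, hxv]
    refine ⟨?_, ?_, ?_⟩ <;> nlinarith
  have T12 : ∀ a b z t, (a = x ∧ b = v ∨ a = v ∧ b = x) → Ptolemy4 Gs.dist a b z t := by
    rintro a b z t (⟨rfl, rfl⟩ | ⟨rfl, rfl⟩)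
    · exact T z t
    · exact (T z t).swap₁₂ hd
  have T13 : ∀ a b z t, (a = x ∧ z = v ∨ a = v ∧ z = x) → Ptolemy4 Gs.dist a b z t :=
    fun a b z t h => (T12 a z b t h).swap₂₃ hd
  have T14 : ∀ a b z t, (a = x ∧ t = v ∨ a = v ∧ t = x) → Ptolemy4 Gs.dist a b z t :=
    fun a b z t h => (T13 a b t z h).swap₃₄ hd
  have E : ∀ a b, ¬ (a = x ∧ b = v ∨ a = v ∧ b = x) →
      Gs.dist a b = Gs.dist (fold x v a) (fold x v b) := by
    intro a b hab
    by_cases ha : a = v <;> by_cases hb : b = v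
    · simp [ha, hb]
    · subst ha
      rw [fold_self, fold_of_ne hb]
      exact h.dist_eq hc (by tauto) hb
    · subst hb
      rw [fold_self, fold_of_ne ha, hd, hd a x]
      exact h.dist_eq hc (by tauto) ha
    · rw [fold_of_ne ha, fold_of_ne hb]
  by_cases h12 : a = x ∧ b = v ∨ a = v ∧ b = x
  · exact T12 _ _ _ _ h12
  by_cases h13 : a = x ∧ c = v ∨ a = v ∧ c = x
  · exact T13 _ _ _ _ h13
  by_cases h14 : a = x ∧ e = v ∨ a = v ∧ e = x
  · exact T14 _ _ _ _ h14
  by_cases h23 : b = x ∧ c = v ∨ b = v ∧ c = x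
  · exact (T13 _ _ _ _ h23).swap₁₂ hd
  by_cases h24 : b = x ∧ e = v ∨ b = v ∧ e = x
  · exact (T14 _ _ _ _ h24).swap₁₂ hd
  by_cases h34 : c = x ∧ e = v ∨ c = v ∧ e = x
  · exact ((T14 _ _ _ _ h34).swap₁₂ hd).swap₂₃ hd
  have := hp _ _ _ _ (fold_ne h.adj.ne a) (fold_ne h.adj.ne b) (fold_ne h.adj.ne c)
    (fold_ne h.adj.ne e)
  unfold Ptolemy4 at this ⊢
  rwa [E a b h12, E a c h13, E a e h14, E b c h23, E b e h24, E c e h34]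

/-- The conditions survive the insertion of a joint twin. -/
theorem Good.of_jointTwins {x v : X} (hle : G ≤ Gs) (hc : Gs.Connected)
    (h : JointTwins G Gs x v)
    (hg : Good (G.comap (Subtype.val : {z | z ≠ v} → X))
      (Gs.comap (Subtype.val : {z | z ≠ v} → X))) : Good G Gs where
  le := hle
  conn := hc
  ptolemy a b c e := by
    refine (h.ptolemy hc (fun a b c e ha hb hc' he => ?_) a b c e).1
    have hd : ∀ a b, Gs.dist a b = Gs.dist b a := fun _ _ => dist_comm
    have := ptolemy4_of_forall (fun _ _ => dist_comm) hg.ptolemy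
      ⟨a, ha⟩ ⟨b, hb⟩ ⟨c, hc'⟩ ⟨e, he⟩
    simpa only [Ptolemy4, (h.connected_compl hc).2] using this
  noP4 a b c d h1 h2 h3 h4 h5 h6 g1 g2 g3 := by
    -- `P₄` has no twins, so `v` can be replaced by `x`
    have n1 := h1.ne
    have n2 := h2.ne
    have n3 := h3.ne
    have n4 := g1.ne
    have n5 := g2.ne
    have n6 := g3.ne
    have key : ∀ a b c d, a ≠ v → b ≠ v → c ≠ v → d ≠ v → G.Adj a b → G.Adj b c → G.Adj c d →
        ¬ G.Adj a c → ¬ G.Adj a d → ¬ G.Adj b d →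
        Gs.Adj a c → Gs.Adj a d → Gs.Adj b d → False :=
      fun a b c d ha hb hc hd => hg.noP4 ⟨a, ha⟩ ⟨b, hb⟩ ⟨c, hc⟩ ⟨d, hd⟩
    have tw := h.iff₂
    have tws := h.iff₁
    have s1 := fun p q => G.adj_comm p q
    have s2 := fun p q => Gs.adj_comm p q
    by_cases ha : a = v
    · subst ha
      have : b ≠ x := by rintro rfl; exact h4 ((tw c n2.symm n4.symm).1 h2)
      have : c ≠ x := by rintro rfl; exact h5 ((tw d n3.symm n5.symm).1 h3)
      have : d ≠ x := by rintro rfl; exact h4 ((tw c n3 n4.symm).1 h3.symm)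
      refine key x b c d h.adj.ne n1.symm n4.symm n5.symm ?_ h2 h3 ?_ ?_ h6 ?_ ?_ g3 <;> grind
    by_cases hb : b = v
    · subst hb
      have : a ≠ x := by rintro rfl; exact h4 ((tw c n4.symm n2.symm).2 h2)
      have : c ≠ x := by rintro rfl; exact h6 ((tw d n3.symm n6.symm).1 h3)
      have : d ≠ x := by rintro rfl; exact h5 ((tw a n5 n1).2 h1.symm).symm
      refine key a x c d n1 h.adj.ne n2.symm n6.symm ?_ ?_ h3 h4 h5 ?_ g1 g2 ?_ <;> grind
    by_cases hc' : c = v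
    · subst hc'
      have : a ≠ x := by rintro rfl; exact h5 ((tw d n5.symm n3.symm).2 h3)
      have : b ≠ x := by rintro rfl; exact h6 ((tw d n6.symm n3.symm).2 h3)
      have : d ≠ x := by rintro rfl; exact h6 ((tw b n6 n2).2 h2.symm).symm
      refine key a b x d n4 n2 h.adj.ne n3.symm h1 ?_ ?_ ?_ h5 h6 ?_ g2 g3 <;> grind
    by_cases hd : d = v
    · subst hd
      have : a ≠ x := by rintro rfl; exact h6 ((tw b n1.symm n6).1 h1).symm
      have : b ≠ x := by rintro rfl; exact h5 ((tw a n1 n5).1 h1.symm).symm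
      have : c ≠ x := by rintro rfl; exact h6 ((tw b n2 n6).1 h2.symm).symm
      refine key a b c x n5 n6 n3 h.adj.ne h1 h2 ?_ h4 ?_ ?_ g1 ?_ ?_ <;> grind
    exact key a b c d ha hb hc' hd h1 h2 h3 h4 h5 h6 g1 g2 g3
  noDiamond p q z w h1 h2 h3 h4 h5 hne h6 h7 := by
    have key : ∀ p q z w, p ≠ v → q ≠ v → z ≠ v → w ≠ v → Gs.Adj p q → Gs.Adj p z → Gs.Adj p w →
        Gs.Adj q z → Gs.Adj q w → z ≠ w → ¬ Gs.Adj z w → G.Adj p z → G.Adj q z :=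
      fun p q z w ha hb hc hd h1 h2 h3 h4 h5 h6 =>
        hg.noDiamond ⟨p, ha⟩ ⟨q, hb⟩ ⟨z, hc⟩ ⟨w, hd⟩ h1 h2 h3 h4 h5
          (fun h => h6 (congrArg Subtype.val h))
    have n1 := h1.ne
    have n2 := h2.ne
    have n3 := h3.ne
    have n4 := h4.ne
    have n5 := h5.ne
    have tw := h.iff₂
    have tws := h.iff₁
    have s1 := fun p q => G.adj_comm p q
    have s2 := fun p q => Gs.adj_comm p q
    by_cases hp : p = v
    · subst hp
      by_cases hq : q = x
      · subst hq; exact (tw z n4.symm n2.symm).2 h7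
      have : z ≠ x := by rintro rfl; exact h6 ((tws w hne.symm n3.symm).2 h3)
      have : w ≠ x := by rintro rfl; exact h6 ((tws z hne n2.symm).2 h2).symm
      refine key x q z w h.adj.ne n1.symm n2.symm n3.symm ?_ ?_ ?_ h4 h5 hne h6 ?_ <;> grind
    by_cases hq : q = v
    · subst hq
      by_cases hpx : p = x
      · subst hpx; exact (tw z n2.symm n4.symm).1 h7
      have : z ≠ x := by rintro rfl; exact h6 ((tws w hne.symm n5.symm).2 h5)
      have : w ≠ x := by rintro rfl; exact h6 ((tws z hne n4.symm).2 h4).symm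
      refine (tw z ‹_› n4.symm).1 ?_
      refine key p x z w n1 h.adj.ne n4.symm n5.symm ?_ ?_ ?_ ?_ ?_ hne h6 ?_ <;> grind
    by_cases hz : z = v
    · subst hz
      have : p ≠ x := by rintro rfl; exact h6 ((tws w n3.symm hne.symm).1 h3)
      have : q ≠ x := by rintro rfl; exact h6 ((tws w n5.symm hne.symm).1 h5)
      have : w ≠ x := by rintro rfl; exact h6 h.adj.symm
      refine ((tw q ‹_› hq).1 (G.adj_symm ?_)).symm
      refine key p q x w n2 n4 h.adj.ne hne.symm ?_ ?_ ?_ ?_ ?_ ?_ ?_ ?_ <;> grind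
    by_cases hw : w = v
    · subst hw
      have : p ≠ x := by rintro rfl; exact h6 ((tws z n2.symm hz).1 h2).symm
      have : q ≠ x := by rintro rfl; exact h6 ((tws z n4.symm hz).1 h4).symm
      have : z ≠ x := by rintro rfl; exact h6 h.adj
      refine key p q z x n3 n5 hne h.adj.ne h1 h2 ?_ h4 ?_ ?_ ?_ h7 <;> grind
    exact key p q z w hp hq hz hw h1 h2 h3 h4 h5 hne h6 h7

end Composition

/-! ### Gluing at a cut vertex -/

section Cut

variable {X : Type*} {G Gs : SimpleGraph X}

/-- The vertex `s` separates the graph `Gs` into the parts `A` and `B`, which have only `s` in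
common. Either part may be trivial. -/
structure IsCut (Gs : SimpleGraph X) (s : X) (A B : Set X) : Prop where
  cover : ∀ z, z ∈ A ∨ z ∈ B
  left : s ∈ A
  right : s ∈ B
  inter : ∀ z, z ∈ A → z ∈ B → z = s
  not_adj : ∀ a b, a ∈ A → b ∈ B → a ≠ s → b ≠ s → ¬ Gs.Adj a b

lemma IsCut.symm {s : X} {A B : Set X} (h : IsCut Gs s A B) : IsCut Gs s B A where
  cover z := (h.cover z).symm
  left := h.right
  right := h.left
  inter z h1 h2 := h.inter z h2 h1
  not_adj a b h1 h2 h3 h4 h5 := h.not_adj b a h2 h1 h4 h3 h5.symm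

open Classical in
/-- The map that fixes `A` and sends everything else to `s`. -/
noncomputable def proj (A : Set X) (s : X) : X → X := fun z => if z ∈ A then z else s

lemma proj_of_mem {A : Set X} {s z : X} (h : z ∈ A) : proj A s z = z := if_pos h

lemma IsCut.proj_of_mem {s : X} {A B : Set X} (h : IsCut Gs s A B) {z : X} (hz : z ∈ B) :
    proj A s z = s := by
  unfold proj
  split_ifs with h'
  · exact h.inter z h' hz
  · rfl

/-- Every edge lies in one of the two parts. -/
lemma IsCut.adj_mem {s : X} {A B : Set X} (h : IsCut Gs s A B) {a b : X} (hab : Gs.Adj a b) :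
    (a ∈ A ∧ b ∈ A) ∨ (a ∈ B ∧ b ∈ B) := by
  have h1 := h.cover a
  have h2 := h.cover b
  have h3 := h.not_adj a b
  have h4 := h.not_adj b a
  have h5 := hab.symm
  have h6 := h.left
  have h7 := h.right
  by_cases ha : a = s <;> by_cases hb : b = s <;> grind

lemma IsCut.proj_adj {s : X} {A B : Set X} (h : IsCut Gs s A B) {a b : X} (hab : Gs.Adj a b) :
    proj A s a = proj A s b ∨ Gs.Adj (proj A s a) (proj A s b) := by
  rcases h.adj_mem hab with ⟨ha, hb⟩ | ⟨ha, hb⟩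
  · rw [ArborealNet.proj_of_mem ha, ArborealNet.proj_of_mem hb]; exact Or.inr hab
  · rw [h.proj_of_mem ha, h.proj_of_mem hb]; exact Or.inl rfl

lemma IsCut.connected_left {s : X} {A B : Set X} (h : IsCut Gs s A B) (hc : Gs.Connected) :
    (Gs.comap (Subtype.val : A → X)).Connected ∧
      ∀ a b : A, (Gs.comap (Subtype.val : A → X)).dist a b = Gs.dist a.1 b.1 := by
  refine retract_subset hc A (proj A s) (fun z => ?_) (fun _ ha => ArborealNet.proj_of_mem ha)
    (fun _ _ hab => h.proj_adj hab)
  unfold proj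
  split_ifs with h'
  · exact h'
  · exact h.left

/-- A walk between the two parts passes through the cut vertex, so distances add up. -/
lemma IsCut.dist_eq {s : X} {A B : Set X} (h : IsCut Gs s A B) (hc : Gs.Connected) {a b : X}
    (ha : a ∈ A) (hb : b ∈ B) : Gs.dist a b = Gs.dist a s + Gs.dist s b := by
  refine le_antisymm hc.dist_triangle ?_
  have key : ∀ {y z : X} (p : Gs.Walk y z), Gs.dist (proj A s y) (proj A s z) +
      Gs.dist (proj B s y) (proj B s z) ≤ p.length := by
    intro y z p
    induction p with
    | nil => simp
    | @cons y m z hym p ih =>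
      rw [Walk.length_cons]
      -- an edge inside one part is collapsed by the projection to the other part
      rcases h.adj_mem hym with ⟨hy, hm⟩ | ⟨hy, hm⟩
      · rw [h.symm.proj_of_mem hy]
        rw [h.symm.proj_of_mem hm] at ih
        rw [ArborealNet.proj_of_mem hy]
        rw [ArborealNet.proj_of_mem hm] at ih
        have : Gs.dist y (proj A s z) ≤ Gs.dist y m + Gs.dist m (proj A s z) := hc.dist_triangle
        rw [dist_eq_one_iff_adj.2 hym] at this
        omega
      · rw [h.proj_of_mem hy]
        rw [h.proj_of_mem hm] at ih
        rw [ArborealNet.proj_of_mem hy]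
        rw [ArborealNet.proj_of_mem hm] at ih
        have : Gs.dist y (proj B s z) ≤ Gs.dist y m + Gs.dist m (proj B s z) := hc.dist_triangle
        rw [dist_eq_one_iff_adj.2 hym] at this
        omega
  obtain ⟨p, hp⟩ := hc.exists_walk_length_eq_dist a b
  have := key p
  rwa [ArborealNet.proj_of_mem ha, h.proj_of_mem hb, h.symm.proj_of_mem ha,
    ArborealNet.proj_of_mem hb, hp] at this

lemma IsCut.ptolemy_three_one {s : X} {A B : Set X} (h : IsCut Gs s A B) (hc : Gs.Connected)
    (hA : ∀ a b c e, a ∈ A → b ∈ A → c ∈ A → e ∈ A → Ptolemy4 Gs.dist a b c e)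
    {a b c e : X} (ha : a ∈ A) (hb : b ∈ A) (hc' : c ∈ A) (he : e ∈ B) :
    Ptolemy4 Gs.dist a b c e := by
  have hs := hA a b c s ha hb hc' h.left
  have t1 : Gs.dist a b ≤ Gs.dist a c + Gs.dist c b := hc.dist_triangle
  have t2 : Gs.dist a c ≤ Gs.dist a b + Gs.dist b c := hc.dist_triangle
  have t3 : Gs.dist b c ≤ Gs.dist b a + Gs.dist a c := hc.dist_triangle
  rw [dist_comm (u := c) (v := b)] at t1
  rw [dist_comm (u := b) (v := a)] at t3
  have m1 := Nat.mul_le_mul_left (Gs.dist s e) t1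
  have m2 := Nat.mul_le_mul_left (Gs.dist s e) t2
  have m3 := Nat.mul_le_mul_left (Gs.dist s e) t3
  obtain ⟨h1, h2, h3⟩ := hs
  simp only [Ptolemy4, h.dist_eq hc ha he, h.dist_eq hc hb he, h.dist_eq hc hc' he]
  refine ⟨?_, ?_, ?_⟩ <;> nlinarith

/-- The four-point configurations split evenly by a cut vertex only need the triangle
inequality. -/
lemma ptolemy_two_two_arith {a b c e x y : ℕ} (h1 : x ≤ a + b) (h2 : y ≤ c + e)
    (h3 : a ≤ x + b) (h4 : b ≤ x + a) (h5 : c ≤ y + e) (h6 : e ≤ y + c) :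
    x * y ≤ (a + c) * (b + e) + (a + e) * (b + c) ∧
    (a + c) * (b + e) ≤ x * y + (a + e) * (b + c) ∧
    (a + e) * (b + c) ≤ x * y + (a + c) * (b + e) := by
  refine ⟨(Nat.mul_le_mul h1 h2).trans (by nlinarith [Nat.zero_le (a * b), Nat.zero_le (c * e)]),
    ?_, ?_⟩
  · zify at *
    rcases le_total (a : ℤ) b with h | h <;> rcases le_total (c : ℤ) e with h' | h' <;>
      nlinarith [mul_nonneg (sub_nonneg.2 h) (sub_nonneg.2 h')]
  · zify at *
    rcases le_total (a : ℤ) b with h | h <;> rcases le_total (c : ℤ) e with h' | h' <;>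
      nlinarith [mul_nonneg (sub_nonneg.2 h) (sub_nonneg.2 h')]

lemma IsCut.ptolemy_two_two {s : X} {A B : Set X} (h : IsCut Gs s A B) (hc : Gs.Connected)
    {a b c e : X} (ha : a ∈ A) (hb : b ∈ A) (hc' : c ∈ B) (he : e ∈ B) :
    Ptolemy4 Gs.dist a b c e := by
  have t1 : Gs.dist a b ≤ Gs.dist a s + Gs.dist s b := hc.dist_triangle
  have t2 : Gs.dist a s ≤ Gs.dist a b + Gs.dist b s := hc.dist_triangle
  have t3 : Gs.dist b s ≤ Gs.dist b a + Gs.dist a s := hc.dist_triangle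
  have t4 : Gs.dist c e ≤ Gs.dist c s + Gs.dist s e := hc.dist_triangle
  have t5 : Gs.dist c s ≤ Gs.dist c e + Gs.dist e s := hc.dist_triangle
  have t6 : Gs.dist e s ≤ Gs.dist e c + Gs.dist c s := hc.dist_triangle
  rw [dist_comm (u := s) (v := b)] at t1
  rw [dist_comm (u := b) (v := a)] at t3
  rw [dist_comm (u := s) (v := e)] at t4
  rw [dist_comm (u := e) (v := c)] at t6
  obtain ⟨h1, h2, h3⟩ := ptolemy_two_two_arith t1 t4 t2 t3 t5 t6
  simp only [Ptolemy4, h.dist_eq hc ha he, h.dist_eq hc hb he, h.dist_eq hc ha hc',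
    h.dist_eq hc hb hc', dist_comm (u := s)]
  refine ⟨?_, ?_, ?_⟩ <;> linarith

lemma IsCut.ptolemy {s : X} {A B : Set X} (h : IsCut Gs s A B) (hc : Gs.Connected)
    (hA : ∀ a b c e, a ∈ A → b ∈ A → c ∈ A → e ∈ A → Ptolemy4 Gs.dist a b c e)
    (hB : ∀ a b c e, a ∈ B → b ∈ B → c ∈ B → e ∈ B → Ptolemy4 Gs.dist a b c e) (a b c e : X) :
    Ptolemy4 Gs.dist a b c e := by
  have hd : ∀ a b, Gs.dist a b = Gs.dist b a := fun _ _ => dist_comm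
  rcases h.cover a with ha | ha <;> rcases h.cover b with hb | hb <;>
    rcases h.cover c with hc' | hc' <;> rcases h.cover e with he | he
  · exact hA a b c e ha hb hc' he
  · exact h.ptolemy_three_one hc hA ha hb hc' he
  · exact (h.ptolemy_three_one hc hA ha hb he hc').swap₃₄ hd
  · exact h.ptolemy_two_two hc ha hb hc' he
  · exact ((h.ptolemy_three_one hc hA ha hc' he hb).swap₃₄ hd).swap₂₃ hd
  · exact (h.ptolemy_two_two hc ha hc' hb he).swap₂₃ hd
  · exact ((h.ptolemy_two_two hc ha he hb hc').swap₂₃ hd).swap₃₄ hd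
  · exact (((h.symm.ptolemy_three_one hc hB hb hc' he ha).swap₃₄ hd).swap₂₃ hd).swap₁₂ hd
  · exact (((h.ptolemy_three_one hc hA hb hc' he ha).swap₃₄ hd).swap₂₃ hd).swap₁₂ hd
  · exact ((h.symm.ptolemy_two_two hc ha he hb hc').swap₂₃ hd).swap₃₄ hd
  · exact (h.symm.ptolemy_two_two hc ha hc' hb he).swap₂₃ hd
  · exact ((h.symm.ptolemy_three_one hc hB ha hc' he hb).swap₃₄ hd).swap₂₃ hd
  · exact h.symm.ptolemy_two_two hc ha hb hc' he
  · exact (h.symm.ptolemy_three_one hc hB ha hb he hc').swap₃₄ hd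
  · exact h.symm.ptolemy_three_one hc hB ha hb hc' he
  · exact hB a b c e ha hb hc' he

lemma Good.ptolemy4_subtype {A : Set X}
    (hg : Good (G.comap (Subtype.val : A → X)) (Gs.comap (Subtype.val : A → X)))
    (hd : ∀ a b : A, (Gs.comap (Subtype.val : A → X)).dist a b = Gs.dist a.1 b.1)
    (a b c e : X) (ha : a ∈ A) (hb : b ∈ A) (hc : c ∈ A) (he : e ∈ A) :
    Ptolemy4 Gs.dist a b c e := by
  have := ptolemy4_of_forall (fun _ _ => dist_comm) hg.ptolemy
    ⟨a, ha⟩ ⟨b, hb⟩ ⟨c, hc⟩ ⟨e, he⟩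
  simpa only [Ptolemy4, hd] using this

/-- The conditions hold for a graph glued at a cut vertex from two parts satisfying them. -/
theorem Good.of_isCut {s : X} {A B : Set X} (hle : G ≤ Gs) (hc : Gs.Connected)
    (h : IsCut Gs s A B)
    (hA : Good (G.comap (Subtype.val : A → X)) (Gs.comap (Subtype.val : A → X)))
    (hB : Good (G.comap (Subtype.val : B → X)) (Gs.comap (Subtype.val : B → X))) :
    Good G Gs where
  le := hle
  conn := hc
  ptolemy a b c e := (h.ptolemy hc (hA.ptolemy4_subtype (h.connected_left hc).2)
    (hB.ptolemy4_subtype (h.symm.connected_left hc).2) a b c e).1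
  noP4 a b c d h1 h2 h3 h4 h5 h6 g1 g2 g3 := by
    have m1 := h.adj_mem (hle h1)
    have m2 := h.adj_mem (hle h2)
    have m3 := h.adj_mem (hle h3)
    have m4 := h.adj_mem g1
    have m5 := h.adj_mem g2
    have m6 := h.adj_mem g3
    have n1 := h1.ne
    have n2 := h2.ne
    have n3 := h3.ne
    have n4 := g1.ne
    have n5 := g2.ne
    have n6 := g3.ne
    have key : (a ∈ A ∧ b ∈ A ∧ c ∈ A ∧ d ∈ A) ∨ (a ∈ B ∧ b ∈ B ∧ c ∈ B ∧ d ∈ B) := by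
      have := h.inter
      grind
    rcases key with ⟨ha, hb, hc, hd⟩ | ⟨ha, hb, hc, hd⟩
    · exact hA.noP4 ⟨a, ha⟩ ⟨b, hb⟩ ⟨c, hc⟩ ⟨d, hd⟩ h1 h2 h3 h4 h5 h6 g1 g2 g3
    · exact hB.noP4 ⟨a, ha⟩ ⟨b, hb⟩ ⟨c, hc⟩ ⟨d, hd⟩ h1 h2 h3 h4 h5 h6 g1 g2 g3
  noDiamond a b c d h1 h2 h3 h4 h5 hne h6 h7 := by
    have m1 := h.adj_mem h1
    have m2 := h.adj_mem h2
    have m3 := h.adj_mem h3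
    have m4 := h.adj_mem h4
    have m5 := h.adj_mem h5
    have n1 := h1.ne
    have n2 := h2.ne
    have n3 := h3.ne
    have n4 := h4.ne
    have n5 := h5.ne
    have key : (a ∈ A ∧ b ∈ A ∧ c ∈ A ∧ d ∈ A) ∨ (a ∈ B ∧ b ∈ B ∧ c ∈ B ∧ d ∈ B) := by
      have := h.inter
      grind
    rcases key with ⟨ha, hb, hc, hd⟩ | ⟨ha, hb, hc, hd⟩
    · exact hA.noDiamond ⟨a, ha⟩ ⟨b, hb⟩ ⟨c, hc⟩ ⟨d, hd⟩ h1 h2 h3 h4 h5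
        (fun h => hne (congrArg Subtype.val h)) h6 h7
    · exact hB.noDiamond ⟨a, ha⟩ ⟨b, hb⟩ ⟨c, hc⟩ ⟨d, hd⟩ h1 h2 h3 h4 h5
        (fun h => hne (congrArg Subtype.val h)) h6 h7

end Cut

/-! ### Decomposition of graphs satisfying the conditions -/

section Cograph

variable {X : Type*} {G : SimpleGraph X}

/-- The vertices in `S` induce no path on four vertices. Distinctness of `a`, `b`, `c`, `d` is
implied by the adjacencies. -/
def NoP4On (G : SimpleGraph X) (S : Finset X) : Prop :=
  ∀ a ∈ S, ∀ b ∈ S, ∀ c ∈ S, ∀ d ∈ S, G.Adj a b → G.Adj b c → G.Adj c d →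
    ¬ G.Adj a c → ¬ G.Adj a d → ¬ G.Adj b d → False

lemma NoP4On.mono {S T : Finset X} (h : NoP4On G T) (hST : S ⊆ T) : NoP4On G S :=
  fun a ha b hb c hc d hd => h a (hST ha) b (hST hb) c (hST hc) d (hST hd)

/-- The path on four vertices is self-complementary. -/
lemma NoP4On.compl {S : Finset X} (h : NoP4On G S) : NoP4On Gᶜ S := by
  intro a ha b hb c hc d hd h1 h2 h3 h4 h5 h6
  rw [compl_adj] at *
  have s := fun p q => G.adj_comm p q
  refine h b hb d hd a ha c hc ?_ ?_ ?_ ?_ ?_ ?_ <;> grind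

variable [DecidableEq X]

/-- `S` splits into two nonempty parts with all edges, or none, between them. -/
def SplitsUniformly (G : SimpleGraph X) (S : Finset X) : Prop :=
  ∃ A ⊆ S, A.Nonempty ∧ (S \ A).Nonempty ∧
    ((∀ a ∈ A, ∀ b ∈ S \ A, G.Adj a b) ∨ (∀ a ∈ A, ∀ b ∈ S \ A, ¬ G.Adj a b))

lemma SplitsUniformly.of_compl {S : Finset X} (h : SplitsUniformly Gᶜ S) :
    SplitsUniformly G S := by
  obtain ⟨A, hA, h1, h2, h3 | h3⟩ := h
  · exact ⟨A, hA, h1, h2, Or.inr fun a ha b hb => (compl_adj _ _ _).1 (h3 a ha b hb) |>.2⟩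
  · refine ⟨A, hA, h1, h2, Or.inl fun a ha b hb => ?_⟩
    have := h3 a ha b hb
    rw [compl_adj] at this
    have hne : a ≠ b := by rintro rfl; exact (Finset.mem_sdiff.1 hb).2 ha
    tauto

/-- A split without edges in between extends to one more vertex. -/
lemma SplitsUniformly.insert_of_not_adj {S A : Finset X} {v : X} (hv : v ∉ S) (hAS : A ⊆ S)
    (hA : A.Nonempty) (hB : (S \ A).Nonempty) (hn : ∀ a ∈ A, ∀ b ∈ S \ A, ¬ G.Adj a b)
    (h : NoP4On G (insert v S)) : SplitsUniformly G (insert v S) := by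
  classical
  have s := fun p q => G.adj_comm p q
  -- the non-neighbours of `v` in a part where `v` has both kinds split off
  have main : ∀ A ⊆ S, (∀ a ∈ A, ∀ b ∈ S \ A, ¬ G.Adj a b) → (∃ a ∈ A, ¬ G.Adj v a) →
      (∃ c ∈ S \ A, G.Adj v c) → SplitsUniformly G (insert v S) := by
    rintro A hAS hn ⟨b, hb, hvb⟩ ⟨c, hc, hvc⟩
    refine ⟨A.filter fun a => ¬ G.Adj v a, ?_, ⟨b, by simp [hb, hvb]⟩, ⟨v, ?_⟩, Or.inr ?_⟩
    · intro a ha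
      exact Finset.mem_insert_of_mem (hAS (Finset.mem_filter.1 ha).1)
    · simp only [Finset.mem_sdiff, Finset.mem_insert, true_or, Finset.mem_filter, true_and]
      exact fun h => hv (hAS h.1)
    · intro p hp q hq hpq
      simp only [Finset.mem_filter, Finset.mem_sdiff, Finset.mem_insert] at hp hq
      rw [Finset.mem_sdiff] at hc
      rcases hq.1 with rfl | hqS
      · exact hp.2 hpq.symm
      by_cases hqA : q ∈ A
      · have hvq : G.Adj v q := by grind
        refine h c ?_ v ?_ q ?_ p ?_ hvc.symm hvq hpq.symm ?_ ?_ hp.2 <;> grind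
      · exact hn p hp.1 q (Finset.mem_sdiff.2 ⟨hqS, hqA⟩) hpq
  by_cases h1 : ∀ a ∈ A, ¬ G.Adj v a
  · refine ⟨A, by grind, hA, ⟨v, by grind⟩, Or.inr ?_⟩
    intro a ha b hb
    have := hn a ha b
    grind
  by_cases h2 : ∀ a ∈ S \ A, ¬ G.Adj v a
  · refine ⟨S \ A, by grind, hB, ⟨v, by grind⟩, Or.inr ?_⟩
    intro a ha b hb
    have := fun hb => hn b hb a ha
    grind
  by_cases h3 : ∀ a ∈ S, G.Adj v a
  · exact ⟨{v}, by simp, by simp, hA.mono (by grind), Or.inl (by grind)⟩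
  push Not at h1 h2 h3
  obtain ⟨b, hb, hvb⟩ := h3
  by_cases hbA : b ∈ A
  · exact main A hAS hn ⟨b, hbA, hvb⟩ h2
  · have e : S \ (S \ A) = A := Finset.sdiff_sdiff_eq_self hAS
    refine main (S \ A) (by grind) ?_ ⟨b, by grind, hvb⟩ (by rwa [e])
    rw [e]
    exact fun a ha b hb hab => hn b hb a ha hab.symm

/-- A `P₄`-free graph on at least two vertices, or its complement, is disconnected. -/
lemma NoP4On.splitsUniformly (S : Finset X) (h : NoP4On G S) (hS : 2 ≤ S.card) :
    SplitsUniformly G S := by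
  induction S using Finset.induction_on with
  | empty => simp at hS
  | insert v S hv ih =>
    rw [Finset.card_insert_of_notMem hv] at hS
    by_cases hS2 : 2 ≤ S.card
    · obtain ⟨A, hAS, hA, hB, hu | hu⟩ := ih (h.mono (Finset.subset_insert v S)) hS2
      · refine SplitsUniformly.of_compl (SplitsUniformly.insert_of_not_adj hv hAS hA hB ?_ h.compl)
        intro a ha b hb hab
        exact ((compl_adj _ _ _).1 hab).2 (hu a ha b hb)
      · exact SplitsUniformly.insert_of_not_adj hv hAS hA hB hu h
    · obtain ⟨x, rfl⟩ := Finset.card_eq_one.1 (by omega : S.card = 1)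
      refine ⟨{v}, by simp, by simp, ⟨x, by grind⟩, ?_⟩
      by_cases hvx : G.Adj v x
      · exact Or.inl (by grind)
      · exact Or.inr (by grind)

/-- A `P₄`-free graph on at least two vertices has a pair of (true or false) twins. -/
lemma NoP4On.exists_twins (S : Finset X) (h : NoP4On G S) (hS : 2 ≤ S.card) :
    ∃ x ∈ S, ∃ y ∈ S, x ≠ y ∧ ∀ z ∈ S, z ≠ x → z ≠ y → (G.Adj x z ↔ G.Adj y z) := by
  induction S using Finset.strongInduction with
  | H S ih =>
    -- twins inside one part of a uniform split are twins
    have part : ∀ A ⊆ S, (S \ A).Nonempty → 2 ≤ A.card →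
        ((∀ a ∈ A, ∀ b ∈ S \ A, G.Adj a b) ∨ (∀ a ∈ A, ∀ b ∈ S \ A, ¬ G.Adj a b)) →
        ∃ x ∈ S, ∃ y ∈ S, x ≠ y ∧ ∀ z ∈ S, z ≠ x → z ≠ y → (G.Adj x z ↔ G.Adj y z) := by
      intro A hAS hB hA2 hu
      have hss : A ⊂ S := by
        refine hAS.ssubset_of_ne ?_
        rintro rfl
        simp at hB
      obtain ⟨x, hx, y, hy, hxy, ht⟩ := ih A hss (h.mono hAS) hA2
      refine ⟨x, hAS hx, y, hAS hy, hxy, fun z hz h1 h2 => ?_⟩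
      by_cases hzA : z ∈ A
      · exact ht z hzA h1 h2
      · have hz' := Finset.mem_sdiff.2 ⟨hz, hzA⟩
        rcases hu with hu | hu
        · exact iff_of_true (hu x hx z hz') (hu y hy z hz')
        · exact iff_of_false (hu x hx z hz') (hu y hy z hz')
    obtain ⟨A, hAS, hA, hB, hu⟩ := h.splitsUniformly S hS
    by_cases hA2 : 2 ≤ A.card
    · exact part A hAS hB hA2 hu
    by_cases hB2 : 2 ≤ (S \ A).card
    · have e : S \ (S \ A) = A := Finset.sdiff_sdiff_eq_self hAS
      refine part (S \ A) Finset.sdiff_subset (by rwa [e]) hB2 ?_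
      rw [e]
      exact hu.imp (fun h a ha b hb => (h b hb a ha).symm)
        (fun h a ha b hb hab => h b hb a ha hab.symm)
    · obtain ⟨x, rfl⟩ := Finset.card_eq_one.1 (by have := hA.card_pos; omega : A.card = 1)
      obtain ⟨y, hy⟩ := Finset.card_eq_one.1 (by have := hB.card_pos; omega : (S \ {x}).card = 1)
      have hS' : ∀ z ∈ S, z = x ∨ z = y := by
        intro z hz
        by_contra! hne
        have : z ∈ S \ {x} := by simp [hz, hne.1]
        rw [hy, Finset.mem_singleton] at this
        exact hne.2 this
      have hyS : y ∈ S \ {x} := by simp [hy]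
      rw [Finset.mem_sdiff, Finset.mem_singleton] at hyS
      refine ⟨x, hAS (by simp), y, hyS.1, Ne.symm hyS.2, fun z hz h1 h2 => ?_⟩
      exact absurd (hS' z hz) (by tauto)

end Cograph

section Decomposition

variable {X : Type*} {G Gs : SimpleGraph X}

lemma Good.no_induced_four_cycle (h : Good G Gs) {u w x y : X} (huw : u ≠ w) (hn : ¬ Gs.Adj u w)
    (h1 : Gs.Adj u x) (h2 : Gs.Adj w x) (h3 : Gs.Adj u y) (h4 : Gs.Adj w y) (hxy : x ≠ y) :
    Gs.Adj x y := by
  by_contra hn'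
  have e1 := h.conn.one_lt_dist_of_ne_of_not_adj huw hn
  have e2 := h.conn.one_lt_dist_of_ne_of_not_adj hxy hn'
  have := h.ptolemy u x w y
  rw [dist_eq_one_iff_adj.2 h1, dist_eq_one_iff_adj.2 h4, dist_eq_one_iff_adj.2 h3,
    dist_eq_one_iff_adj.2 h2.symm] at this
  nlinarith

/-- There is no gem: a path `a`, `b`, `c`, `d` together with a vertex `x` adjacent to all of it. -/
lemma Good.no_gem (h : Good G Gs) {a b c d x : X} (h1 : Gs.Adj a b) (h2 : Gs.Adj b c)
    (h3 : Gs.Adj c d) (h4 : ¬ Gs.Adj a c) (h5 : ¬ Gs.Adj b d) (hac : a ≠ c) (hbd : b ≠ d)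
    (h7 : Gs.Adj x a) (h8 : Gs.Adj x d) : False := by
  have e1 := h.conn.one_lt_dist_of_ne_of_not_adj hac h4
  have e2 := h.conn.one_lt_dist_of_ne_of_not_adj hbd h5
  have e3 : Gs.dist a d ≤ Gs.dist a x + Gs.dist x d := h.conn.dist_triangle
  rw [dist_eq_one_iff_adj.2 h7.symm, dist_eq_one_iff_adj.2 h8] at e3
  have := h.ptolemy a b c d
  rw [dist_eq_one_iff_adj.2 h1, dist_eq_one_iff_adj.2 h2, dist_eq_one_iff_adj.2 h3] at this
  nlinarith

/-- Let `u`, `w` be vertices at distance two with the fewest common neighbours. Then all common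
neighbours of `u` and `w` have the same closed neighbourhood. -/
lemma Good.adj_of_minimal [Finite X] (h : Good G Gs) {u w : X} (huw : u ≠ w) (hn : ¬ Gs.Adj u w)
    (hmin : ∀ p q, p ≠ q → ¬ Gs.Adj p q → (Gs.commonNeighbors p q).Nonempty →
      (Gs.commonNeighbors u w).ncard ≤ (Gs.commonNeighbors p q).ncard)
    {x y z : X} (hx : x ∈ Gs.commonNeighbors u w) (hy : y ∈ Gs.commonNeighbors u w)
    (hzy : z ≠ y) (hxz : Gs.Adj x z) : Gs.Adj y z := by
  by_contra hyz
  rw [mem_commonNeighbors] at hx hy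
  have hxy : x ≠ y := by rintro rfl; exact hyz hxz
  have axy : Gs.Adj x y := h.no_induced_four_cycle huw hn hx.1 hx.2 hy.1 hy.2 hxy
  have hyz' : ¬ Gs.Adj z y := fun h' => hyz h'.symm
  have hn' : ¬ Gs.Adj w u := fun h' => hn h'.symm
  have hzu : ¬ Gs.Adj u z := by
    intro hzu
    by_cases hzw : Gs.Adj w z
    · exact hyz (h.no_induced_four_cycle huw hn hzu hzw hy.1 hy.2 hzy).symm
    · exact h.no_gem hy.2 hy.1.symm hzu hn' hyz huw.symm hzy.symm hx.2.symm hxz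
  have hzu' : z ≠ u := by rintro rfl; exact hyz hy.1.symm
  have hlt : ¬ Gs.commonNeighbors z u ⊆ Gs.commonNeighbors u w := by
    intro hsub
    have hss : Gs.commonNeighbors z u ⊂ Gs.commonNeighbors u w :=
      ⟨hsub, fun h' => hyz ((mem_commonNeighbors Gs).1 (h' ((mem_commonNeighbors Gs).2 hy))).1.symm⟩
    have := hmin z u hzu' (fun h' => hzu h'.symm) ⟨x, hxz.symm, hx.1⟩
    have := Set.ncard_lt_ncard hss (Set.toFinite _)
    omega
  obtain ⟨p, hp, hp'⟩ := Set.not_subset.1 hlt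
  rw [mem_commonNeighbors] at hp hp'
  have hpw : ¬ Gs.Adj w p := fun h' => hp' ⟨hp.2, h'⟩
  have hpw' : ¬ Gs.Adj p w := fun h' => hpw h'.symm
  have hpx : Gs.Adj x p := by
    refine h.no_induced_four_cycle hzu' (fun h' => hzu h'.symm) hxz.symm hx.1 hp.1 hp.2 ?_
    rintro rfl
    exact hpw hx.2
  have hne : p ≠ w := by rintro rfl; exact hn hp.2
  by_cases hpy : Gs.Adj p y
  · exact h.no_gem hp.1 hpy hy.2.symm hyz' hpw' hzy hne hxz hx.2.symm
  · refine h.no_gem hp.2.symm hy.1 hy.2.symm hpy hn ?_ huw hpx hx.2.symm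
    rintro rfl
    exact hyz hp.1.symm

/-- A clique whose vertices have the same closed neighbourhood in `Gs`, and which is a module of
`G`, contains a pair of joint twins. -/
lemma Good.exists_jointTwins (h : Good G Gs) (K : Finset X) (hK : 2 ≤ K.card)
    (hadj : ∀ x ∈ K, ∀ y ∈ K, x ≠ y → Gs.Adj x y)
    (h1 : ∀ x ∈ K, ∀ y ∈ K, ∀ z, z ≠ y → Gs.Adj x z → Gs.Adj y z)
    (h2 : ∀ x ∈ K, ∀ y ∈ K, ∀ z, z ∉ K → G.Adj x z → G.Adj y z) :
    ∃ x v, JointTwins G Gs x v := by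
  classical
  have hP : NoP4On G K := by
    intro a ha b hb c hc d hd e1 e2 e3 e4 e5 e6
    refine h.noP4 a b c d e1 e2 e3 e4 e5 e6 (hadj a ha c hc ?_) (hadj a ha d hd ?_)
      (hadj b hb d hd ?_)
    · rintro rfl; exact e5 e3
    · rintro rfl; exact e4 e3.symm
    · rintro rfl; exact e5 e1
  obtain ⟨x, hx, v, hv, hxv, ht⟩ := hP.exists_twins K hK
  refine ⟨x, v, hadj x hx v hv hxv, fun z hzx hzv => ⟨h1 x hx v hv z hzv, h1 v hv x hx z hzx⟩,
    fun z hzx hzv => ?_⟩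
  by_cases hz : z ∈ K
  · exact ht z hz hzx hzv
  · exact ⟨h2 x hx v hv z hz, h2 v hv x hx z hz⟩

/-- If `x` is the only common neighbour of two vertices `u`, `w` at distance two, then it
separates them: otherwise, as `Gs` is distance-hereditary, they would be at distance two in the
graph without `x`. -/
lemma Good.exists_isCut (h : Good G Gs) {u w x : X} (huw : u ≠ w) (hn : ¬ Gs.Adj u w)
    (hx : Gs.commonNeighbors u w = {x}) :
    ∃ A B, IsCut Gs x A B ∧ (∃ a ∈ A, a ≠ x) ∧ ∃ b ∈ B, b ≠ x := by
  have hx' : x ∈ Gs.commonNeighbors u w := by simp [hx]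
  rw [mem_commonNeighbors] at hx'
  have hux : u ≠ x := hx'.1.ne
  have hwx : w ≠ x := hx'.2.ne
  let H := Gs.comap (Subtype.val : {z | z ≠ x} → X)
  let C : Set X := {z | ∃ hz : z ≠ x, H.Reachable ⟨u, hux⟩ ⟨z, hz⟩}
  have hw : w ∉ C := by
    rintro ⟨hz, hr⟩
    have hd := dist_comap_eq h.conn h.ptolemy Subtype.val_injective hr
    have h2 := h.conn.one_lt_dist_of_ne_of_not_adj huw hn
    have h3 : Gs.dist u w ≤ Gs.dist u x + Gs.dist x w := h.conn.dist_triangle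
    rw [dist_eq_one_iff_adj.2 hx'.1, dist_eq_one_iff_adj.2 hx'.2.symm] at h3
    obtain ⟨c, hc, hcr, hcd⟩ := exists_adj_dist_succ (k := 1) (hd.trans (show Gs.dist u w = 2 by omega))
    rw [dist_eq_one_iff_adj] at hcd
    have : c.1 ∈ Gs.commonNeighbors u w := ⟨hc, hcd.symm⟩
    rw [hx, Set.mem_singleton_iff] at this
    exact c.2 this
  refine ⟨insert x C, Cᶜ, ⟨fun z => ?_, Set.mem_insert _ _, ?_, ?_, ?_⟩,
    ⟨u, Or.inr ⟨hux, Reachable.refl _⟩, hux⟩, ⟨w, hw, hwx⟩⟩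
  · by_cases hz : z ∈ C
    · exact Or.inl (Or.inr hz)
    · exact Or.inr hz
  · rintro ⟨hz, -⟩; exact hz rfl
  · rintro z (rfl | hz) hz'
    · rfl
    · exact absurd hz hz'
  · rintro a b (rfl | ⟨ha, hr⟩) hb hax hbx hab
    · exact hax rfl
    · have : H.Adj ⟨a, ha⟩ ⟨b, hbx⟩ := hab
      exact hb ⟨hbx, hr.trans this.reachable⟩

/-- A pair satisfying the conditions has joint twins or a cut vertex. -/
theorem Good.jointTwins_or_isCut [Finite X] [Nontrivial X] (h : Good G Gs) :
    (∃ x v, JointTwins G Gs x v) ∨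
      ∃ s A B, IsCut Gs s A B ∧ (∃ a ∈ A, a ≠ s) ∧ ∃ b ∈ B, b ≠ s := by
  classical
  have := Fintype.ofFinite X
  by_cases hcomp : ∀ x y, x ≠ y → Gs.Adj x y
  · left
    refine h.exists_jointTwins Finset.univ ?_ (fun x _ y _ => hcomp x y)
      (fun x _ y _ z hz _ => hcomp y z hz.symm) (fun x _ y _ z hz => by simp at hz)
    rw [Finset.card_univ]
    exact Fintype.one_lt_card
  push Not at hcomp
  obtain ⟨x₀, y₀, hne, hna⟩ := hcomp
  have hex : ∃ n, ∃ u w, u ≠ w ∧ ¬ Gs.Adj u w ∧ (Gs.commonNeighbors u w).Nonempty ∧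
      (Gs.commonNeighbors u w).ncard = n := by
    obtain ⟨p, hp⟩ := h.conn.exists_walk_length_eq_dist x₀ y₀
    obtain ⟨u, a, w, h1, h2, h3, h4⟩ := Walk.exists_adj_adj_not_adj_ne hp
      (h.conn.one_lt_dist_of_ne_of_not_adj hne hna)
    exact ⟨_, u, w, h4, h3, ⟨a, h1, h2.symm⟩, rfl⟩
  obtain ⟨u, w, huw, hn, hK, hcard⟩ := Nat.find_spec hex
  have hmin : ∀ p q, p ≠ q → ¬ Gs.Adj p q → (Gs.commonNeighbors p q).Nonempty →
      (Gs.commonNeighbors u w).ncard ≤ (Gs.commonNeighbors p q).ncard := by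
    intro p q h1 h2 h3
    rw [hcard]
    exact Nat.find_min' hex ⟨p, q, h1, h2, h3, rfl⟩
  by_cases hone : ∃ x, Gs.commonNeighbors u w = {x}
  · obtain ⟨x, hx⟩ := hone
    exact Or.inr ⟨x, h.exists_isCut huw hn hx⟩
  left
  have hmem : ∀ x, x ∈ (Gs.commonNeighbors u w).toFinset ↔ Gs.Adj u x ∧ Gs.Adj w x := by
    simp [mem_commonNeighbors]
  have htw : ∀ x ∈ (Gs.commonNeighbors u w).toFinset, ∀ y ∈ (Gs.commonNeighbors u w).toFinset,
      ∀ z, z ≠ y → Gs.Adj x z → Gs.Adj y z := fun x hx y hy z hz hxz =>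
    h.adj_of_minimal huw hn hmin (Set.mem_toFinset.1 hx) (Set.mem_toFinset.1 hy) hz hxz
  refine h.exists_jointTwins (Gs.commonNeighbors u w).toFinset ?_ ?_ htw ?_
  · rw [← Set.ncard_eq_toFinset_card']
    by_contra hlt
    have := (Set.ncard_pos (Set.toFinite _)).2 hK
    exact hone (Set.ncard_eq_one.1 (by omega))
  · intro x hx y hy hxy
    rw [hmem] at hx hy
    exact h.no_induced_four_cycle huw hn hx.1 hx.2 hy.1 hy.2 hxy
  · -- one of `u`, `w` completes an asymmetric diamond
    intro x hx y hy z hz hxz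
    by_cases hxy : x = y
    · rwa [← hxy]
    have hyz : Gs.Adj y z := htw x hx y hy z (by rintro rfl; exact hz hy) (h.le hxz)
    rw [hmem] at hx hy hz
    have axy := h.no_induced_four_cycle huw hn hx.1 hx.2 hy.1 hy.2 hxy
    have key : ∀ t, Gs.Adj t x → Gs.Adj t y → z ≠ t → ¬ Gs.Adj z t → G.Adj y z :=
      fun t h1 h2 h3 h4 => h.noDiamond x y z t axy (h.le hxz) h1.symm hyz h2.symm h3 h4 hxz
    by_cases hzu : z = u
    · exact key w hx.2 hy.2 (hzu ▸ huw) (hzu ▸ hn)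
    by_cases hzw : z = w
    · exact key u hx.1 hy.1 (hzw ▸ huw.symm) (hzw ▸ fun h' => hn h'.symm)
    by_cases hau : Gs.Adj u z
    · exact key w hx.2 hy.2 hzw fun h' => hz ⟨hau, h'.symm⟩
    · exact key u hx.1 hy.1 hzu fun h' => hau h'.symm

end Decomposition

/-! ### Ancestry in oriented forests -/

section SharedAncestry

variable {V : Type*} {D : Digraph V}

/-- Two distinct vertices (not only leaves) are adjacent when they have a common ancestor. -/
def shareGraph (D : Digraph V) : SimpleGraph V where
  Adj x y := x ≠ y ∧ ShareAncestor D x y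
  symm := ⟨fun _ _ h => ⟨h.1.symm, let ⟨a, hx, hy⟩ := h.2; ⟨a, hy, hx⟩⟩⟩
  loopless := ⟨fun _ h => h.1 rfl⟩

/-- Two distinct vertices (not only leaves) are adjacent when they have a least common ancestor
satisfying `t`. -/
def lcaGraph (D : Digraph V) (t : V → Prop) : SimpleGraph V where
  Adj x y := x ≠ y ∧ ∃ a, IsLCA D a x y ∧ t a
  symm := ⟨fun _ _ h => ⟨h.1.symm, let ⟨a, ha, ht⟩ := h.2
    ⟨a, ⟨ha.1.symm, fun c hc h' => ha.2 c hc h'.symm⟩, ht⟩⟩⟩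
  loopless := ⟨fun _ h => h.1 rfl⟩

lemma lcaGraph_le_shareGraph (D : Digraph V) (t : V → Prop) : lcaGraph D t ≤ shareGraph D :=
  fun _ _ h => ⟨h.1, let ⟨a, ha, _⟩ := h.2; ⟨a, ha.1⟩⟩

/-- The subdigraph induced on a set of vertices. -/
def inducedOn (D : Digraph V) (S : Set V) : Digraph S where
  Adj a b := D.Adj a.1 b.1

/-- `S` contains all directed paths between its vertices, and all common ancestors of two distinct
vertices of `S`. -/
structure AncestryClosed (D : Digraph V) (S : Set V) : Prop where
  convex : ∀ a b c, a ∈ S → b ∈ S → IsAncestor D a c → IsAncestor D c b → c ∈ S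
  common : ∀ x y a, x ∈ S → y ∈ S → x ≠ y → IsAncestor D a x → IsAncestor D a y → a ∈ S

lemma AncestryClosed.isAncestor_iff {S : Set V} (h : AncestryClosed D S) (a b : S) :
    IsAncestor (inducedOn D S) a b ↔ IsAncestor D a.1 b.1 := by
  constructor
  · intro hab
    induction hab with
    | refl => exact Relation.ReflTransGen.refl
    | tail _ h ih => exact Relation.ReflTransGen.tail ih h
  · obtain ⟨a, ha⟩ := a
    obtain ⟨b, hb⟩ := b
    intro hab
    change IsAncestor D a b at hab
    induction hab using Relation.ReflTransGen.head_induction_on with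
    | refl => exact Relation.ReflTransGen.refl
    | @head a c hac hcb ih =>
      have hc : c ∈ S := h.convex a b c ha hb (Relation.ReflTransGen.single hac) hcb
      exact Relation.ReflTransGen.head (show (inducedOn D S).Adj ⟨a, ha⟩ ⟨c, hc⟩ from hac) (ih hc)

lemma AncestryClosed.shareGraph_eq {S : Set V} (h : AncestryClosed D S) :
    shareGraph (inducedOn D S) = (shareGraph D).comap (Subtype.val : S → V) := by
  ext x y
  constructor
  · rintro ⟨hne, a, h1, h2⟩
    exact ⟨Subtype.val_injective.ne hne, a, (h.isAncestor_iff _ _).1 h1, (h.isAncestor_iff _ _).1 h2⟩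
  · rintro ⟨hne, a, h1, h2⟩
    exact ⟨fun e => hne (congrArg _ e), ⟨a, h.common _ _ a x.2 y.2 hne h1 h2⟩,
      (h.isAncestor_iff _ _).2 h1, (h.isAncestor_iff _ _).2 h2⟩

lemma AncestryClosed.lcaGraph_eq {S : Set V} (h : AncestryClosed D S) (t : V → Prop) :
    lcaGraph (inducedOn D S) (fun v => t v.1) = (lcaGraph D t).comap (Subtype.val : S → V) := by
  ext x y
  constructor
  · rintro ⟨hne, a, ⟨⟨h1, h2⟩, h3⟩, ht⟩
    rw [h.isAncestor_iff] at h1 h2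
    have hne' := Subtype.val_injective.ne hne
    refine ⟨hne', a, ⟨⟨h1, h2⟩, fun c hc ⟨h4, h5⟩ => ?_⟩, ht⟩
    exact h3 ⟨c, h.common _ _ c x.2 y.2 hne' h4 h5⟩ hc
      ⟨(h.isAncestor_iff _ _).2 h4, (h.isAncestor_iff _ _).2 h5⟩
  · rintro ⟨hne, a, ⟨⟨h1, h2⟩, h3⟩, ht⟩
    refine ⟨fun e => hne (congrArg _ e), ⟨a, h.common _ _ a x.2 y.2 hne h1 h2⟩,
      ⟨⟨(h.isAncestor_iff _ _).2 h1, (h.isAncestor_iff _ _).2 h2⟩, fun c hc ⟨h4, h5⟩ => ?_⟩, ht⟩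
    exact h3 c.1 hc ⟨(h.isAncestor_iff _ _).1 h4, (h.isAncestor_iff _ _).1 h5⟩

lemma isAcyclic_inducedOn (h : IsAcyclic D) (S : Set V) : IsAcyclic (inducedOn D S) := by
  have key : ∀ a b : S, Relation.TransGen (inducedOn D S).Adj a b →
      Relation.TransGen D.Adj a.1 b.1 := by
    intro a b hab
    induction hab with
    | single h => exact .single h
    | tail _ h ih => exact .tail ih h
  exact fun v hv => h v.1 (key v v hv)

lemma isAcyclic_toSimpleGraphInclusive_inducedOn (h : D.toSimpleGraphInclusive.IsAcyclic)
    (S : Set V) : (inducedOn D S).toSimpleGraphInclusive.IsAcyclic := by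
  refine (h.of_comap (Function.Embedding.subtype (· ∈ S))).anti ?_
  intro a b hab
  exact ⟨Subtype.val_injective.ne hab.1, hab.2⟩

lemma exists_sink [Finite V] [Nonempty V] (h : IsAcyclic D) : ∃ s, ∀ c, ¬ D.Adj s c := by
  let r : V → V → Prop := fun a b => Relation.TransGen D.Adj b a
  have : IsTrans V r := ⟨fun _ _ _ h1 h2 => h2.trans h1⟩
  have : Std.Irrefl r := ⟨h⟩
  obtain ⟨s, -, hs⟩ := (Finite.wellFounded_of_trans_of_irrefl r).has_min Set.univ Set.univ_nonempty
  exact ⟨s, fun c hc => hs c trivial (Relation.TransGen.single hc)⟩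

lemma eq_of_isAncestor_of_sink {s v : V} (hs : ∀ c, ¬ D.Adj s c) (h : IsAncestor D s v) :
    v = s := by
  rcases Relation.ReflTransGen.cases_head h with h | ⟨c, hc, -⟩
  · exact h.symm
  · exact absurd hc (hs c)

/-- A sink with a single parent is a joint twin of that parent. -/
lemma jointTwins_of_sink {s p : V} (hac : IsAcyclic D) (hs : ∀ c, ¬ D.Adj s c) (hp : D.Adj p s)
    (huniq : ∀ q, D.Adj q s → q = p) (t : V → Prop) :
    JointTwins (lcaGraph D t) (shareGraph D) p s := by
  have hne : p ≠ s := by rintro rfl; exact hac p (.single hp)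
  have up : ∀ a, a ≠ s → IsAncestor D a s → IsAncestor D a p := by
    intro a ha h
    rcases Relation.ReflTransGen.cases_tail h with h | ⟨q, h1, h2⟩
    · exact absurd h.symm ha
    · exact huniq q h2 ▸ h1
  have down : ∀ a, IsAncestor D a p → IsAncestor D a s := fun a h => h.tail hp
  have ns : ∀ a z, z ≠ s → IsAncestor D a z → a ≠ s := by
    rintro a z hz h rfl
    exact hz (eq_of_isAncestor_of_sink hs h)
  refine ⟨⟨hne, p, .refl, .single hp⟩, fun z hzp hzs => ⟨?_, ?_⟩, fun z hzp hzs => ⟨?_, ?_⟩⟩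
  · rintro ⟨-, a, h1, h2⟩
    exact ⟨hzs.symm, a, down a h1, h2⟩
  · rintro ⟨-, a, h1, h2⟩
    exact ⟨hzp.symm, a, up a (ns a z hzs h2) h1, h2⟩
  · rintro ⟨-, a, ⟨⟨h1, h2⟩, h3⟩, ht⟩
    exact ⟨hzs.symm, a, ⟨⟨down a h1, h2⟩, fun c hc ⟨h4, h5⟩ =>
      h3 c hc ⟨up c (ns c z hzs h5) h4, h5⟩⟩, ht⟩
  · rintro ⟨-, a, ⟨⟨h1, h2⟩, h3⟩, ht⟩
    exact ⟨hzp.symm, a, ⟨⟨up a (ns a z hzs h2) h1, h2⟩, fun c hc ⟨h4, h5⟩ =>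
      h3 c hc ⟨down c h4, h5⟩⟩, ht⟩

lemma ancestryClosed_compl_sink {s : V} (hs : ∀ c, ¬ D.Adj s c) :
    AncestryClosed D {z | z ≠ s} where
  convex a b c _ hb _ hcb := by
    rintro rfl
    exact hb (eq_of_isAncestor_of_sink hs hcb)
  common x y a hx hy _ hax _ := by
    rintro rfl
    exact hx (eq_of_isAncestor_of_sink hs hax)

/-- A sink separates the parts of an oriented forest that hang together when the arc from one of
its parents is cut. -/
lemma exists_isCut_of_sink {s p q : V} (hac : IsAcyclic D)
    (hforest : D.toSimpleGraphInclusive.IsAcyclic)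
    (hs : ∀ c, ¬ D.Adj s c) (hp : D.Adj p s) (hq : D.Adj q s) (hqp : q ≠ p) :
    ∃ A B, IsCut (shareGraph D) s A B ∧ AncestryClosed D A ∧ AncestryClosed D B ∧
      q ∉ A ∧ p ∉ B := by
  have loop : ∀ a b, D.Adj a b → a ≠ b := by
    rintro a b h rfl
    exact hac a (.single h)
  let T : Set V := {v | (D.toSimpleGraphInclusive.deleteEdges {s(p, s)}).Reachable p v}
  have hpT : p ∈ T := Reachable.refl _
  have hsT : s ∉ T :=
    isBridge_iff.1 (isAcyclic_iff_forall_adj_isBridge.1 hforest ⟨loop _ _ hp, Or.inl hp⟩)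
  -- the arc from `p` to `s` is the only one between `T` and its complement
  have step : ∀ a b, D.Adj a b → s(a, b) ≠ s(p, s) → (a ∈ T ↔ b ∈ T) := by
    intro a b hab hne
    have : (D.toSimpleGraphInclusive.deleteEdges {s(p, s)}).Adj a b := by
      rw [deleteEdges_adj]
      exact ⟨⟨loop _ _ hab, Or.inl hab⟩, hne⟩
    exact ⟨fun h => Reachable.trans h this.reachable,
      fun h => Reachable.trans h this.symm.reachable⟩
  have out : ∀ a b, D.Adj a b → a ∈ T → b ∉ T → a = p ∧ b = s := by
    intro a b hab ha hb
    by_cases hne : s(a, b) = s(p, s)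
    · rcases Sym2.eq_iff.1 hne with h | ⟨rfl, rfl⟩
      · exact h
      · exact absurd hab (hs _)
    · exact absurd ((step a b hab hne).1 ha) hb
  have down : ∀ a b, D.Adj a b → a ∉ T → b ∉ T := by
    intro a b hab ha hb
    by_cases hne : s(a, b) = s(p, s)
    · rcases Sym2.eq_iff.1 hne with ⟨rfl, rfl⟩ | ⟨rfl, rfl⟩
      · exact ha hpT
      · exact hs _ hab
    · exact ha ((step a b hab hne).2 hb)
  have anc₁ : ∀ a b, IsAncestor D a b → a ∉ T → b ∉ T := by
    intro a b hab ha
    induction hab with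
    | refl => exact ha
    | tail _ h ih => exact down _ _ h ih
  have anc₂ : ∀ a b, IsAncestor D a b → a ∈ T → b ∈ T ∨ b = s := by
    intro a b hab ha
    induction hab with
    | refl => exact Or.inl ha
    | @tail b c _ h ih =>
      rcases ih with ih | rfl
      · by_cases hc : c ∈ T
        · exact Or.inl hc
        · exact Or.inr (out b c h ih hc).2
      · exact absurd h (hs c)
  refine ⟨insert s T, Tᶜ, ⟨?_, Set.mem_insert _ _, hsT, ?_, ?_⟩, ⟨?_, ?_⟩, ⟨?_, ?_⟩, ?_, ?_⟩
  · intro z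
    by_cases hz : z ∈ T
    · exact Or.inl (Or.inr hz)
    · exact Or.inr hz
  · rintro z (rfl | hz) hz'
    · rfl
    · exact absurd hz hz'
  · rintro a b (rfl | ha) hb has hbs ⟨-, e, h1, h2⟩
    · exact has rfl
    · by_cases he : e ∈ T
      · exact (anc₂ e b h2 he).elim hb hbs
      · exact anc₁ e a h1 he ha
  · rintro a b c (rfl | ha) - h1 -
    · exact Or.inl (eq_of_isAncestor_of_sink hs h1)
    · exact (anc₂ a c h1 ha).symm
  · rintro x y a hx hy hxy h1 h2
    by_cases ha : a ∈ T
    · exact Or.inr ha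
    · exact absurd ((hx.resolve_right (anc₁ a x h1 ha)).trans
        (hy.resolve_right (anc₁ a y h2 ha)).symm) hxy
  · intro a b c ha _ h1 _
    exact anc₁ a c h1 ha
  · intro x y a hx hy hxy h1 h2 ha
    exact hxy (((anc₂ a x h1 ha).resolve_left hx).trans ((anc₂ a y h2 ha).resolve_left hy).symm)
  · rintro (h | h)
    · exact loop _ _ hq h
    · exact hqp (out q s hq h hsT).1
  · exact fun h => h hpT

lemma Good.of_subsingleton {X : Type*} [Subsingleton X] {G Gs : SimpleGraph X} (hle : G ≤ Gs)
    (hc : Gs.Connected) : Good G Gs where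
  le := hle
  conn := hc
  ptolemy x y z t := by simp [Subsingleton.elim x z]
  noP4 a b _ _ h1 := absurd (Subsingleton.elim a b) h1.ne
  noDiamond a b _ _ h1 := absurd (Subsingleton.elim a b) h1.ne

/-- An oriented forest yields a pair of graphs satisfying the conditions: a sink with one parent
is a joint twin of it, and a sink with several parents is a cut vertex. -/
theorem good_lcaGraph_shareGraph {V : Type*} [Finite V] (D : Digraph V) (t : V → Prop)
    (hac : IsAcyclic D)
    (hforest : D.toSimpleGraphInclusive.IsAcyclic) (hc : (shareGraph D).Connected) :
    Good (lcaGraph D t) (shareGraph D) := by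
  induction hn : Nat.card V using Nat.strong_induction_on generalizing V with
  | _ n ih =>
    have := hc.nonempty
    have hsub : ∀ S : Set V, (∃ v, v ∉ S) → AncestryClosed D S →
        ((shareGraph D).comap (Subtype.val : S → V)).Connected →
        Good ((lcaGraph D t).comap (Subtype.val : S → V))
          ((shareGraph D).comap (Subtype.val : S → V)) := by
      rintro S ⟨v, hv⟩ hS hSc
      rw [← hS.shareGraph_eq] at hSc ⊢
      rw [← hS.lcaGraph_eq]
      refine ih _ ?_ _ _ (isAcyclic_inducedOn hac S)
        (isAcyclic_toSimpleGraphInclusive_inducedOn hforest S) hSc rfl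
      rw [← hn]
      exact Finite.card_subtype_lt hv
    rcases subsingleton_or_nontrivial V with hV | hV
    · exact .of_subsingleton (lcaGraph_le_shareGraph D t) hc
    obtain ⟨s, hs⟩ := exists_sink hac
    have hpar : ∃ p, D.Adj p s := by
      obtain ⟨y, hy⟩ := exists_ne s
      obtain ⟨w⟩ := hc.preconnected s y
      cases w with
      | nil => exact absurd rfl hy
      | @cons _ z _ hsz _ =>
        obtain ⟨hne, a, h1, h2⟩ := hsz
        rcases Relation.ReflTransGen.cases_tail h1 with h | ⟨q, -, hq⟩
        · subst h
          exact absurd (eq_of_isAncestor_of_sink hs h2).symm hne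
        · exact ⟨q, hq⟩
    obtain ⟨p, hp⟩ := hpar
    by_cases huniq : ∀ q, D.Adj q s → q = p
    · have hj := jointTwins_of_sink hac hs hp huniq t
      exact .of_jointTwins (lcaGraph_le_shareGraph D t) hc hj
        (hsub _ ⟨s, fun h => h rfl⟩ (ancestryClosed_compl_sink hs) (hj.connected_compl hc).1)
    · push Not at huniq
      obtain ⟨q, hq, hqp⟩ := huniq
      obtain ⟨A, B, hcut, hA, hB, hqA, hpB⟩ := exists_isCut_of_sink hac hforest hs hp hq hqp
      exact .of_isCut (lcaGraph_le_shareGraph D t) hc hcut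
        (hsub A ⟨q, hqA⟩ hA (hcut.connected_left hc).1)
        (hsub B ⟨p, hpB⟩ hB (hcut.symm.connected_left hc).1)

end SharedAncestry

/-! ### Representations by digraphs, and cherries -/

section Construction

variable {V W X : Type*} {D : Digraph V}

lemma outdegree_eq_zero [Finite V] {v : V} : outdegree D v = 0 ↔ ∀ c, ¬ D.Adj v c := by
  rw [outdegree, Set.ncard_eq_zero (Set.toFinite _), Set.eq_empty_iff_forall_notMem]
  rfl

/-- In an acyclic digraph arcs correspond to edges, so counting arcs by their heads counts the
edges of the underlying graph. -/
lemma isTree_iff_sum_indegree [Fintype V] (hac : IsAcyclic D) :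
    D.toSimpleGraphInclusive.IsTree ↔
      D.toSimpleGraphInclusive.Connected ∧ ∑ v, indegree D v + 1 = Fintype.card V := by
  have loop : ∀ a b, D.Adj a b → a ≠ b := by
    rintro a b h rfl
    exact hac a (.single h)
  let g : (Σ v : V, {p : V // D.Adj p v}) → D.toSimpleGraphInclusive.edgeSet :=
    fun q => ⟨s(q.2.1, q.1), loop _ _ q.2.2, Or.inl q.2.2⟩
  have hg : Function.Bijective g := by
    constructor
    · rintro ⟨v, p, hp⟩ ⟨w, q, hq⟩ h
      rcases Sym2.eq_iff.1 (congrArg Subtype.val h) with ⟨h1, h2⟩ | ⟨h1, h2⟩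
      · dsimp only at h1 h2
        subst h1 h2
        rfl
      · dsimp only at h1 h2
        subst h1 h2
        exact absurd (Relation.TransGen.tail (.single hp) hq) (hac _)
    · rintro ⟨e, he⟩
      induction e using Sym2.ind with
      | _ a b =>
        rcases he with ⟨-, h | h⟩
        · exact ⟨⟨b, a, h⟩, rfl⟩
        · exact ⟨⟨a, b, h⟩, Subtype.ext Sym2.eq_swap⟩
  have hcard : Nat.card D.toSimpleGraphInclusive.edgeSet = ∑ v, indegree D v := by
    rw [← Nat.card_eq_of_bijective g hg, Nat.card_sigma]
    rfl
  rw [isTree_iff_connected_and_card, hcard, Nat.card_eq_fintype_card]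

/-- `D` with its vertices marked by `t` represents `(G, Gs)`: its leaves are identified with the
vertices of the graphs through `f`. -/
structure Represents (D : Digraph V) (t : V → Prop) (f : X → V) (G Gs : SimpleGraph X) : Prop where
  injective : f.Injective
  leaf_iff : ∀ v, outdegree D v = 0 ↔ v ∈ Set.range f
  share : Gs = (shareGraph D).comap f
  lca : G = (lcaGraph D t).comap f

lemma Represents.sink [Finite V] {t : V → Prop} {f : X → V} {G Gs : SimpleGraph X}
    (h : Represents D t f G Gs) (x : X) : ∀ c, ¬ D.Adj (f x) c :=
  outdegree_eq_zero.1 ((h.leaf_iff _).2 ⟨x, rfl⟩)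

lemma Represents.share_adj {t : V → Prop} {f : X → V} {G Gs : SimpleGraph X}
    (h : Represents D t f G Gs) (x y : X) : Gs.Adj x y ↔ (shareGraph D).Adj (f x) (f y) :=
  iff_of_eq (congrArg (fun H => H.Adj x y) h.share)

lemma Represents.lca_adj {t : V → Prop} {f : X → V} {G Gs : SimpleGraph X}
    (h : Represents D t f G Gs) (x y : X) : G.Adj x y ↔ (lcaGraph D t).Adj (f x) (f y) :=
  iff_of_eq (congrArg (fun H => H.Adj x y) h.lca)

/-- Adjacencies transfer between two digraphs in which the common ancestors correspond. -/
lemma adj_iff_of_common {D' : Digraph W} {t : V → Prop} {t' : W → Prop} {u v : V} {u' v' : W}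
    (i : V → W) (huv : u ≠ v) (huv' : u' ≠ v')
    (hanc : ∀ b, (IsAncestor D' b u' ∧ IsAncestor D' b v') ↔
      ∃ a, i a = b ∧ IsAncestor D a u ∧ IsAncestor D a v)
    (hadj : ∀ a c, IsAncestor D a u ∧ IsAncestor D a v → IsAncestor D c u ∧ IsAncestor D c v →
      (D'.Adj (i a) (i c) ↔ D.Adj a c))
    (ht : ∀ a, IsAncestor D a u ∧ IsAncestor D a v → (t' (i a) ↔ t a)) :
    ((shareGraph D').Adj u' v' ↔ (shareGraph D).Adj u v) ∧
      ((lcaGraph D' t').Adj u' v' ↔ (lcaGraph D t).Adj u v) := by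
  refine ⟨⟨?_, ?_⟩, ⟨?_, ?_⟩⟩
  · rintro ⟨-, b, hb⟩
    obtain ⟨a, -, ha⟩ := (hanc b).1 hb
    exact ⟨huv, a, ha⟩
  · rintro ⟨-, a, ha⟩
    exact ⟨huv', i a, (hanc _).2 ⟨a, rfl, ha⟩⟩
  · rintro ⟨-, b, ⟨hb, hc⟩, htb⟩
    obtain ⟨a, rfl, ha⟩ := (hanc b).1 hb
    exact ⟨huv, a, ⟨ha, fun c hac h => hc (i c) ((hadj a c ha h).2 hac) ((hanc _).2 ⟨c, rfl, h⟩)⟩,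
      (ht a ha).1 htb⟩
  · rintro ⟨-, a, ⟨ha, hc⟩, hta⟩
    refine ⟨huv', i a, ⟨(hanc _).2 ⟨a, rfl, ha⟩, fun b hb h => ?_⟩, (ht a ha).2 hta⟩
    obtain ⟨c, rfl, h'⟩ := (hanc b).1 h
    exact hc c ((hadj a c ha h').1 hb) h'

/-- Two new leaves are attached to the vertex `x`. -/
def cherry (D : Digraph V) (x : V) : Digraph (V ⊕ Bool) where
  Adj
    | .inl a, .inl b => D.Adj a b
    | .inl a, .inr _ => a = x
    | .inr _, _ => False

section Cherry

variable {x : V}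

lemma cherry_isAncestor_inr {b : Bool} {w : V ⊕ Bool} :
    IsAncestor (cherry D x) (.inr b) w ↔ w = .inr b :=
  ⟨fun h => eq_of_isAncestor_of_sink (fun _ h => h) h, fun h => h ▸ .refl⟩

lemma cherry_isAncestor_inl {a b : V} :
    IsAncestor (cherry D x) (.inl a) (.inl b) ↔ IsAncestor D a b := by
  constructor
  · intro h
    have key : ∀ w, IsAncestor (cherry D x) (.inl a) w →
        match w with | .inl b => IsAncestor D a b | .inr _ => True := by
      intro w hw
      induction hw with
      | refl => exact .refl
      | @tail p q _ hpq ih =>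
        match p, q with
        | .inl _, .inl _ => exact Relation.ReflTransGen.tail ih hpq
        | .inl _, .inr _ => trivial
        | .inr _, _ => exact hpq.elim
    exact key _ h
  · intro h
    induction h with
    | refl => exact .refl
    | @tail p q _ hpq ih =>
      exact Relation.ReflTransGen.tail ih (show (cherry D x).Adj (.inl p) (.inl q) from hpq)

lemma cherry_isAncestor_inl_inr {a : V} {b : Bool} :
    IsAncestor (cherry D x) (.inl a) (.inr b) ↔ IsAncestor D a x := by
  constructor
  · intro h
    rcases Relation.ReflTransGen.cases_tail h with h | ⟨p, h1, h2⟩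
    · cases h
    · match p with
      | .inl p =>
        obtain rfl : p = x := h2
        exact cherry_isAncestor_inl.1 h1
      | .inr _ => exact h2.elim
  · intro h
    exact Relation.ReflTransGen.tail (cherry_isAncestor_inl.2 h)
      (show (cherry D x).Adj (.inl x) (.inr b) from rfl)

lemma cherry_indegree_inl (v : V) : indegree (cherry D x) (.inl v) = indegree D v := by
  rw [indegree, indegree, ← Set.ncard_image_of_injective {p | D.Adj p v} Sum.inl_injective]
  refine congrArg Set.ncard (Set.ext ?_)
  rintro (p | p) <;> simp [cherry]

lemma cherry_indegree_inr (b : Bool) : indegree (cherry D x) (.inr b) = 1 := by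
  rw [indegree, Set.ncard_eq_one]
  refine ⟨.inl x, ?_⟩
  ext (p | p) <;> simp [cherry]

lemma cherry_outdegree_inl {v : V} (hv : v ≠ x) :
    outdegree (cherry D x) (.inl v) = outdegree D v := by
  rw [outdegree, outdegree, ← Set.ncard_image_of_injective {c | D.Adj v c} Sum.inl_injective]
  refine congrArg Set.ncard (Set.ext ?_)
  rintro (p | p) <;> simp [cherry, hv]

lemma cherry_outdegree_inl_self (hx : ∀ c, ¬ D.Adj x c) :
    outdegree (cherry D x) (.inl x) = 2 := by
  rw [outdegree, Set.ncard_eq_two]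
  refine ⟨.inr true, .inr false, by simp, ?_⟩
  ext (p | p)
  · simp [cherry, hx]
  · cases p <;> simp [cherry]

lemma cherry_outdegree_inr (b : Bool) : outdegree (cherry D x) (.inr b) = 0 := by
  simp [outdegree, cherry]

lemma isAcyclic_cherry (hac : IsAcyclic D) : IsAcyclic (cherry D x) := by
  rintro (v | b) h
  · obtain ⟨w, h1, h2⟩ := Relation.TransGen.head'_iff.1 h
    match w with
    | .inl w => exact hac v (Relation.TransGen.head' h1 (cherry_isAncestor_inl.1 h2))
    | .inr b => cases cherry_isAncestor_inr.1 h2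
  · obtain ⟨w, h1, h2⟩ := Relation.TransGen.head'_iff.1 h
    exact h1

lemma isTree_cherry [Finite V] (hac : IsAcyclic D) (ht : D.toSimpleGraphInclusive.IsTree) :
    (cherry D x).toSimpleGraphInclusive.IsTree := by
  have := Fintype.ofFinite V
  have h := (isTree_iff_sum_indegree hac).1 ht
  refine (isTree_iff_sum_indegree (isAcyclic_cherry hac)).2 ⟨?_, ?_⟩
  · have h1 : ∀ a, (cherry D x).toSimpleGraphInclusive.Reachable (.inl x) (.inl a) := fun a =>
      (dist_map_le (Gs := D.toSimpleGraphInclusive) (H := (cherry D x).toSimpleGraphInclusive) Sum.inl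
        (fun a b hab => Or.inr ⟨Sum.inl_injective.ne hab.1, hab.2⟩) (h.1.preconnected x a)).1
    have h2 : ∀ w, (cherry D x).toSimpleGraphInclusive.Reachable (.inl x) w := by
      rintro (a | b)
      · exact h1 a
      · have : (cherry D x).toSimpleGraphInclusive.Adj (.inl x) (.inr b) := ⟨by simp, Or.inl rfl⟩
        exact this.reachable
    exact (connected_iff _).2 ⟨fun a b => (h2 a).symm.trans (h2 b), ⟨.inl x⟩⟩
  · simp only [Fintype.sum_sum_type, cherry_indegree_inl, cherry_indegree_inr, Fintype.card_sum,
      ← h.2]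
    simp

/-- The degree conditions on `D` are not needed at `x`, so that `D` may be a single vertex. -/
lemma isArborealNetwork_cherry [Finite V] (hac : IsAcyclic D)
    (ht : D.toSimpleGraphInclusive.IsTree) (hx : ∀ c, ¬ D.Adj x c)
    (h1 : ∀ v, v ≠ x → indegree D v = 0 → 2 ≤ outdegree D v)
    (h2 : ∀ v, v ≠ x → outdegree D v = 0 → indegree D v = 1)
    (h3 : ∀ v, v ≠ x → ¬ (indegree D v = 1 ∧ outdegree D v = 1)) :
    IsArborealNetwork (cherry D x) where
  finite := inferInstance
  connected := (isTree_cherry hac ht).connected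
  acyclic := isAcyclic_cherry hac
  two_le_outdegree_of_root := by
    rintro (v | b)
    · by_cases hv : v = x
      · subst hv; simp [cherry_outdegree_inl_self hx]
      · rw [cherry_indegree_inl, cherry_outdegree_inl hv]; exact h1 v hv
    · simp [cherry_indegree_inr]
  indegree_of_leaf := by
    rintro (v | b)
    · by_cases hv : v = x
      · subst hv; simp [cherry_outdegree_inl_self hx]
      · rw [cherry_indegree_inl, cherry_outdegree_inl hv]; exact h2 v hv
    · simp [cherry_indegree_inr]
  no_subdivision := by
    rintro (v | b)
    · by_cases hv : v = x
      · subst hv; simp [cherry_outdegree_inl_self hx]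
      · rw [cherry_indegree_inl, cherry_outdegree_inl hv]; exact h3 v hv
    · simp [cherry_outdegree_inr]
  isTree := isTree_cherry hac ht

end Cherry
end Construction

/-! ### Joint twins as the leaves of a cherry -/

section Construction

variable {V W X : Type*} {D : Digraph V}

/-- Replacing the leaf of `x` by a cherry with leaves `x` and `v` inserts a joint twin `v`
of `x`. -/
lemma Represents.exists_cherry [Finite V] {G Gs : SimpleGraph X} {x v : X}
    (hj : JointTwins G Gs x v) {t : V → Prop} {f : {z | z ≠ v} → V}
    (h : Represents D t f (G.comap (Subtype.val : {z | z ≠ v} → X))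
      (Gs.comap (Subtype.val : {z | z ≠ v} → X))) :
    ∃ (t' : V ⊕ Bool → Prop) (f' : X → V ⊕ Bool),
      Represents (cherry D (f ⟨x, hj.adj.ne⟩)) t' f' G Gs := by
  classical
  set x₁ : V := f ⟨x, hj.adj.ne⟩ with hx₁
  have hsink : ∀ z, ∀ c, ¬ D.Adj (f z) c := h.sink
  let t' : V ⊕ Bool → Prop := Sum.elim (fun w => if w = x₁ then G.Adj x v else t w) fun _ => False
  let f' : X → V ⊕ Bool := fun z =>
    if hz : z = v then .inr false else if z = x then .inr true else .inl (f ⟨z, hz⟩)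
  have fv : f' v = .inr false := by simp [f']
  have fx : f' x = .inr true := by simp [f', hj.adj.ne]
  have fo : ∀ z (h1 : z ≠ v), z ≠ x → f' z = .inl (f ⟨z, h1⟩) := by
    intro z h1 h2; simp [f', h1, h2]
  have hne : ∀ z (h1 : z ≠ v), z ≠ x → f ⟨z, h1⟩ ≠ x₁ := by
    intro z h1 h2 e
    exact h2 (congrArg Subtype.val (h.injective e))
  have hs := h.share_adj
  have hl := h.lca_adj
  simp only [comap_adj] at hs hl
  -- a common ancestor of two distinct leaves is not a leaf
  have hanc : ∀ z (h1 : z ≠ v), z ≠ x → ∀ a, IsAncestor D a (f ⟨z, h1⟩) → a ≠ x₁ := by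
    rintro z h1 h2 a ha rfl
    exact hne z h1 h2 (eq_of_isAncestor_of_sink (hsink _) ha)
  have ht : ∀ a, a ≠ x₁ → (t' (.inl a) ↔ t a) := fun a ha => by simp [t', ha]
  have inl_inl : ∀ y z (hy : y ≠ v) (hz : z ≠ v), y ≠ x → z ≠ x → y ≠ z →
      ((shareGraph (cherry D x₁)).Adj (f' y) (f' z) ↔ Gs.Adj y z) ∧
      ((lcaGraph (cherry D x₁) t').Adj (f' y) (f' z) ↔ G.Adj y z) := by
    intro y z hy hz hyx hzx hyz
    have hyz' : f ⟨y, hy⟩ ≠ f ⟨z, hz⟩ := fun e => hyz (congrArg Subtype.val (h.injective e))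
    rw [fo y hy hyx, fo z hz hzx, hs ⟨y, hy⟩ ⟨z, hz⟩, hl ⟨y, hy⟩ ⟨z, hz⟩]
    refine adj_iff_of_common Sum.inl hyz' (Sum.inl_injective.ne hyz') ?_ (fun _ _ _ _ => Iff.rfl)
      (fun a ha => ht a (hanc y hy hyx a ha.1))
    rintro (a | b)
    · simp [cherry_isAncestor_inl]
    · simp [cherry_isAncestor_inr]
  have inl_inr : ∀ y b (hy : y ≠ v), y ≠ x →
      ((shareGraph (cherry D x₁)).Adj (f' y) (.inr b) ↔ Gs.Adj y x) ∧
      ((lcaGraph (cherry D x₁) t').Adj (f' y) (.inr b) ↔ G.Adj y x) := by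
    intro y b hy hyx
    rw [fo y hy hyx, hs ⟨y, hy⟩ ⟨x, hj.adj.ne⟩, hl ⟨y, hy⟩ ⟨x, hj.adj.ne⟩]
    refine adj_iff_of_common Sum.inl (hne y hy hyx) (by simp) ?_ (fun _ _ _ _ => Iff.rfl)
      (fun a ha => ht a (hanc y hy hyx a ha.1))
    rintro (a | b)
    · simp [cherry_isAncestor_inl, cherry_isAncestor_inl_inr, hx₁]
    · simp [cherry_isAncestor_inr]
  have top : (shareGraph (cherry D x₁)).Adj (f' x) (f' v) ∧
      ((lcaGraph (cherry D x₁) t').Adj (f' x) (f' v) ↔ G.Adj x v) := by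
    rw [fx, fv]
    refine ⟨⟨by simp, .inl x₁, .single rfl, .single rfl⟩, ?_, fun hxv => ?_⟩
    · rintro ⟨-, (a | b), ⟨⟨h1, h2⟩, h3⟩, hta⟩
      · rw [cherry_isAncestor_inl_inr] at h1 h2
        rcases Relation.ReflTransGen.cases_head h1 with rfl | ⟨c, hac, hc⟩
        · simpa [t'] using hta
        · exact absurd ⟨cherry_isAncestor_inl_inr.2 hc, cherry_isAncestor_inl_inr.2 hc⟩
            (h3 (.inl c) hac)
      · exact hta.elim
    · refine ⟨by simp, .inl x₁, ⟨⟨.single rfl, .single rfl⟩, ?_⟩, by simpa [t'] using hxv⟩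
      rintro (c | b) hc ⟨h1, h2⟩
      · exact hsink _ c hc
      · rw [cherry_isAncestor_inr] at h1 h2
        simp [← h2] at h1
  have all : ∀ y z, y ≠ z →
      ((shareGraph (cherry D x₁)).Adj (f' y) (f' z) ↔ Gs.Adj y z) ∧
      ((lcaGraph (cherry D x₁) t').Adj (f' y) (f' z) ↔ G.Adj y z) := by
    have hxv := hj.adj.ne
    intro y z hyz
    by_cases hyv : y = v
    · subst hyv
      by_cases hzx : z = x
      · subst hzx
        rw [adj_comm, G.adj_comm, adj_comm (lcaGraph _ _), Gs.adj_comm]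
        exact ⟨iff_of_true top.1 hj.adj, top.2⟩
      · rw [adj_comm, adj_comm (lcaGraph _ _), ← hj.iff₁ z hzx hyz.symm, ← hj.iff₂ z hzx hyz.symm,
          G.adj_comm, Gs.adj_comm, fv]
        exact inl_inr z false hyz.symm hzx
    by_cases hzv : z = v
    · subst hzv
      by_cases hyx : y = x
      · subst hyx
        exact ⟨iff_of_true top.1 hj.adj, top.2⟩
      · rw [G.adj_comm, Gs.adj_comm, ← hj.iff₁ y hyx hyz, ← hj.iff₂ y hyx hyz,
          G.adj_comm, Gs.adj_comm, fv]
        exact inl_inr y false hyz hyx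
    by_cases hyx : y = x
    · subst hyx
      rw [adj_comm, adj_comm (lcaGraph _ _), G.adj_comm, Gs.adj_comm, fx]
      exact inl_inr z true hzv hyz.symm
    by_cases hzx : z = x
    · subst hzx
      rw [fx]
      exact inl_inr y true hyv hyz
    exact inl_inl y z hyv hzv hyx hzx hyz
  refine ⟨t', f', ?_, ?_, ?_, ?_⟩
  · intro y z hyz
    by_cases hyv : y = v
    · by_cases hzv : z = v
      · rw [hyv, hzv]
      by_cases hzx : z = x
      · rw [hyv, hzx, fv, fx] at hyz; cases hyz
      · rw [hyv, fo z hzv hzx, fv] at hyz; cases hyz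
    by_cases hzv : z = v
    · by_cases hyx : y = x
      · rw [hzv, hyx, fv, fx] at hyz; cases hyz
      · rw [hzv, fo y hyv hyx, fv] at hyz; cases hyz
    by_cases hyx : y = x
    · by_cases hzx : z = x
      · rw [hyx, hzx]
      · rw [hyx, fo z hzv hzx, fx] at hyz; cases hyz
    by_cases hzx : z = x
    · rw [hzx, fo y hyv hyx, fx] at hyz; cases hyz
    rw [fo y hyv hyx, fo z hzv hzx] at hyz
    exact congrArg Subtype.val (h.injective (Sum.inl_injective hyz))
  · rintro (w | b)
    · by_cases hw : w = x₁
      · subst hw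
        rw [cherry_outdegree_inl_self (hsink _)]
        refine iff_of_false (by norm_num) ?_
        rintro ⟨z, hz⟩
        by_cases hzv : z = v
        · subst hzv; rw [fv] at hz; cases hz
        by_cases hzx : z = x
        · subst hzx; rw [fx] at hz; cases hz
        rw [fo z hzv hzx] at hz
        exact hne z hzv hzx (Sum.inl_injective hz)
      · rw [cherry_outdegree_inl hw, h.leaf_iff]
        constructor
        · rintro ⟨⟨z, hz⟩, rfl⟩
          exact ⟨z, fo z hz (by rintro rfl; exact hw rfl)⟩
        · rintro ⟨z, hz⟩
          by_cases hzv : z = v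
          · subst hzv; rw [fv] at hz; cases hz
          by_cases hzx : z = x
          · subst hzx; rw [fx] at hz; cases hz
          rw [fo z hzv hzx] at hz
          exact ⟨_, Sum.inl_injective hz⟩
    · refine iff_of_true (cherry_outdegree_inr b) ?_
      cases b
      · exact ⟨v, fv⟩
      · exact ⟨x, fx⟩
  · ext y z
    by_cases hyz : y = z
    · subst hyz; simp
    · exact (all y z hyz).1.symm
  · ext y z
    by_cases hyz : y = z
    · subst hyz; simp
    · exact (all y z hyz).2.symm

/-! ### Gluing two networks at a leaf -/

/-- The digraphs `D₁` and `D₂` are joined at a leaf `x₁` of `D₁` and a leaf `x₂` of `D₂`: the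
vertex `x₁` subdivides the arc into `x₂`, so that it gets two parents and the only child `x₂`. -/
def glue (D₁ : Digraph V) (x₁ : V) (D₂ : Digraph W) (x₂ : W) : Digraph (V ⊕ W) where
  Adj
    | .inl a, .inl b => D₁.Adj a b
    | .inr a, .inr b => D₂.Adj a b ∧ b ≠ x₂
    | .inr a, .inl b => D₂.Adj a x₂ ∧ b = x₁
    | .inl a, .inr b => a = x₁ ∧ b = x₂

section Glue

variable {D₁ : Digraph V} {x₁ : V} {D₂ : Digraph W} {x₂ : W}

lemma glue_isAncestor_of_inl (h₂ : ∀ c, ¬ D₂.Adj x₂ c) {a : V} {w : V ⊕ W}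
    (h : IsAncestor (glue D₁ x₁ D₂ x₂) (.inl a) w) :
    match w with
    | .inl b => IsAncestor D₁ a b
    | .inr b => IsAncestor D₁ a x₁ ∧ b = x₂ := by
  induction h with
  | refl => exact .refl
  | @tail p q _ hpq ih =>
    match p, q with
    | .inl p, .inl q => exact Relation.ReflTransGen.tail ih hpq
    | .inl p, .inr q =>
      obtain ⟨rfl, rfl⟩ := hpq
      exact ⟨ih, rfl⟩
    | .inr p, .inl q =>
      obtain ⟨-, rfl⟩ := ih
      exact absurd hpq.1 (h₂ _)
    | .inr p, .inr q =>
      obtain ⟨-, rfl⟩ := ih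
      exact absurd hpq.1 (h₂ _)

lemma glue_isAncestor_of_inr (h₁ : ∀ c, ¬ D₁.Adj x₁ c) {a : W} {w : V ⊕ W}
    (h : IsAncestor (glue D₁ x₁ D₂ x₂) (.inr a) w) :
    match w with
    | .inl b => Relation.TransGen D₂.Adj a x₂ ∧ b = x₁
    | .inr b => IsAncestor D₂ a b := by
  induction h with
  | refl => exact .refl
  | @tail p q _ hpq ih =>
    match p, q with
    | .inl p, .inl q =>
      obtain ⟨-, rfl⟩ := ih
      exact absurd hpq (h₁ _)
    | .inl p, .inr q =>
      obtain ⟨-, rfl⟩ := hpq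
      exact ih.1.to_reflTransGen
    | .inr p, .inl q => exact ⟨Relation.TransGen.tail' ih hpq.1, hpq.2⟩
    | .inr p, .inr q => exact Relation.ReflTransGen.tail ih hpq.1

lemma glue_isAncestor_inl {a b : V} (h₂ : ∀ c, ¬ D₂.Adj x₂ c) :
    IsAncestor (glue D₁ x₁ D₂ x₂) (.inl a) (.inl b) ↔ IsAncestor D₁ a b := by
  refine ⟨fun h => glue_isAncestor_of_inl h₂ h, fun h => ?_⟩
  induction h with
  | refl => exact .refl
  | @tail p q _ hpq ih =>
    exact Relation.ReflTransGen.tail ih (show (glue D₁ x₁ D₂ x₂).Adj (.inl p) (.inl q) from hpq)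

lemma glue_isAncestor_inl_inr {a : V} {b : W} (h₂ : ∀ c, ¬ D₂.Adj x₂ c) :
    IsAncestor (glue D₁ x₁ D₂ x₂) (.inl a) (.inr b) ↔ IsAncestor D₁ a x₁ ∧ b = x₂ := by
  refine ⟨fun h => glue_isAncestor_of_inl h₂ h, fun ⟨h, hb⟩ => ?_⟩
  exact Relation.ReflTransGen.tail ((glue_isAncestor_inl h₂).2 h)
    (show (glue D₁ x₁ D₂ x₂).Adj (.inl x₁) (.inr b) from ⟨rfl, hb⟩)

lemma glue_isAncestor_inr {a b : W} (h₁ : ∀ c, ¬ D₁.Adj x₁ c) :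
    IsAncestor (glue D₁ x₁ D₂ x₂) (.inr a) (.inr b) ↔ IsAncestor D₂ a b := by
  refine ⟨fun h => glue_isAncestor_of_inr h₁ h, fun h => ?_⟩
  induction h with
  | refl => exact .refl
  | @tail p q _ hpq ih =>
    by_cases hq : q = x₂
    · subst hq
      exact (Relation.ReflTransGen.tail ih
        (show (glue D₁ x₁ D₂ q).Adj (.inr p) (.inl x₁) from ⟨hpq, rfl⟩)).tail
        (show (glue D₁ x₁ D₂ q).Adj (.inl x₁) (.inr q) from ⟨rfl, rfl⟩)
    · exact Relation.ReflTransGen.tail ih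
        (show (glue D₁ x₁ D₂ x₂).Adj (.inr p) (.inr q) from ⟨hpq, hq⟩)

lemma isAcyclic_glue (h₁ : ∀ c, ¬ D₁.Adj x₁ c) (h₂ : ∀ c, ¬ D₂.Adj x₂ c) (hac₁ : IsAcyclic D₁)
    (hac₂ : IsAcyclic D₂) : IsAcyclic (glue D₁ x₁ D₂ x₂) := by
  rintro (v | v) h
  · obtain ⟨w, h1, h2⟩ := Relation.TransGen.head'_iff.1 h
    match w with
    | .inl w => exact hac₁ v (Relation.TransGen.head' h1 (glue_isAncestor_of_inl h₂ h2))
    | .inr w =>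
      obtain ⟨rfl, rfl⟩ := h1
      exact hac₂ _ (glue_isAncestor_of_inr h₁ h2).1
  · obtain ⟨w, h1, h2⟩ := Relation.TransGen.head'_iff.1 h
    match w with
    | .inl w =>
      obtain ⟨-, rfl⟩ := glue_isAncestor_of_inl h₂ h2
      exact h₂ _ h1.1
    | .inr w => exact hac₂ v (Relation.TransGen.head' h1.1 (glue_isAncestor_of_inr h₁ h2))

lemma glue_indegree_inl {v : V} (hv : v ≠ x₁) :
    indegree (glue D₁ x₁ D₂ x₂) (.inl v) = indegree D₁ v := by
  rw [indegree, indegree, ← Set.ncard_image_of_injective {p | D₁.Adj p v} Sum.inl_injective]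
  refine congrArg Set.ncard (Set.ext ?_)
  rintro (p | p) <;> simp [glue, hv]

lemma glue_indegree_inl_self [Finite V] [Finite W] :
    indegree (glue D₁ x₁ D₂ x₂) (.inl x₁) = indegree D₁ x₁ + indegree D₂ x₂ := by
  rw [indegree, indegree, indegree,
    ← Set.ncard_image_of_injective {p | D₁.Adj p x₁} (Sum.inl_injective (β := W)),
    ← Set.ncard_image_of_injective {p | D₂.Adj p x₂} (Sum.inr_injective (α := V)),
    ← Set.ncard_union_eq _ (Set.toFinite _) (Set.toFinite _)]
  · refine congrArg Set.ncard (Set.ext ?_)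
    rintro (p | p) <;> simp [glue]
  · rw [Set.disjoint_left]
    rintro _ ⟨p, -, rfl⟩ ⟨q, -, h⟩
    cases h

lemma glue_indegree_inr {v : W} (hv : v ≠ x₂) :
    indegree (glue D₁ x₁ D₂ x₂) (.inr v) = indegree D₂ v := by
  rw [indegree, indegree, ← Set.ncard_image_of_injective {p | D₂.Adj p v} Sum.inr_injective]
  refine congrArg Set.ncard (Set.ext ?_)
  rintro (p | p) <;> simp [glue, hv]

lemma glue_indegree_inr_self : indegree (glue D₁ x₁ D₂ x₂) (.inr x₂) = 1 := by
  rw [indegree, Set.ncard_eq_one]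
  refine ⟨.inl x₁, Set.ext ?_⟩
  rintro (p | p) <;> simp [glue]

lemma glue_outdegree_inl {v : V} (hv : v ≠ x₁) :
    outdegree (glue D₁ x₁ D₂ x₂) (.inl v) = outdegree D₁ v := by
  rw [outdegree, outdegree, ← Set.ncard_image_of_injective {c | D₁.Adj v c} Sum.inl_injective]
  refine congrArg Set.ncard (Set.ext ?_)
  rintro (p | p) <;> simp [glue, hv]

lemma glue_outdegree_inl_self (h₁ : ∀ c, ¬ D₁.Adj x₁ c) :
    outdegree (glue D₁ x₁ D₂ x₂) (.inl x₁) = 1 := by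
  rw [outdegree, Set.ncard_eq_one]
  refine ⟨.inr x₂, Set.ext ?_⟩
  rintro (p | p) <;> simp [glue, h₁]

/-- In `glue` the child `x₂` of a vertex of `D₂` is replaced by `x₁`. -/
lemma glue_outdegree_inr (v : W) :
    outdegree (glue D₁ x₁ D₂ x₂) (.inr v) = outdegree D₂ v := by
  classical
  let g : W → V ⊕ W := fun c => if c = x₂ then .inl x₁ else .inr c
  have hg : g.Injective := by
    intro a b hab
    by_cases ha : a = x₂ <;> by_cases hb : b = x₂ <;> simp_all [g]
  rw [outdegree, outdegree, ← Set.ncard_image_of_injective {c | D₂.Adj v c} hg]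
  refine congrArg Set.ncard (Set.ext ?_)
  rintro (p | p)
  · constructor
    · rintro ⟨h1, rfl⟩
      exact ⟨x₂, h1, by simp [g]⟩
    · rintro ⟨c, hc, h⟩
      by_cases hc' : c = x₂
      · subst hc'
        simp only [g, if_true] at h
        exact ⟨hc, (Sum.inl_injective h).symm⟩
      · simp [g, hc'] at h
  · constructor
    · rintro ⟨h1, h2⟩
      exact ⟨p, h1, by simp [g, h2]⟩
    · rintro ⟨c, hc, h⟩
      by_cases hc' : c = x₂
      · simp [g, hc'] at h
      · simp only [g, hc', if_false] at h
        obtain rfl := Sum.inr_injective h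
        exact ⟨hc, hc'⟩

/-- Gluing redirects the arc into `x₂` to `x₁` and adds one arc, from `x₁` to `x₂`; this is the right
number of arcs for a tree on the union of the two vertex sets. -/
lemma isTree_glue [Finite V] [Finite W] (h₁ : ∀ c, ¬ D₁.Adj x₁ c) (h₂ : ∀ c, ¬ D₂.Adj x₂ c)
    (hac₁ : IsAcyclic D₁) (hac₂ : IsAcyclic D₂) (hi₂ : indegree D₂ x₂ = 1)
    (ht₁ : D₁.toSimpleGraphInclusive.IsTree) (ht₂ : D₂.toSimpleGraphInclusive.IsTree) :
    (glue D₁ x₁ D₂ x₂).toSimpleGraphInclusive.IsTree := by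
  classical
  have := Fintype.ofFinite V
  have := Fintype.ofFinite W
  have e₁ := (isTree_iff_sum_indegree hac₁).1 ht₁
  have e₂ := (isTree_iff_sum_indegree hac₂).1 ht₂
  refine (isTree_iff_sum_indegree (isAcyclic_glue h₁ h₂ hac₁ hac₂)).2 ⟨?_, ?_⟩
  · set U := (glue D₁ x₁ D₂ x₂).toSimpleGraphInclusive with hU
    have hx : U.Reachable (.inl x₁) (.inr x₂) := by
      have : U.Adj (.inl x₁) (.inr x₂) := ⟨by simp, Or.inl ⟨rfl, rfl⟩⟩
      exact this.reachable
    have r1 : ∀ a, U.Reachable (.inl x₁) (.inl a) := fun a =>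
      (dist_map_le (Gs := D₁.toSimpleGraphInclusive) (H := U) Sum.inl
        (fun a b hab => Or.inr ⟨Sum.inl_injective.ne hab.1, hab.2⟩) (e₁.1.preconnected x₁ a)).1
    have arc : ∀ p q, D₂.Adj p q → U.Reachable (.inr p) (.inr q) := by
      intro p q h
      by_cases hq : q = x₂
      · subst hq
        have : U.Adj (.inr p) (.inl x₁) := ⟨by simp, Or.inl ⟨h, rfl⟩⟩
        exact this.reachable.trans hx
      · have hpq : p ≠ q := by rintro rfl; exact hac₂ p (.single h)
        have : U.Adj (.inr p) (.inr q) := ⟨Sum.inr_injective.ne hpq, Or.inl ⟨h, hq⟩⟩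
        exact this.reachable
    have r2 : ∀ a b, U.Reachable (.inr a) (.inr b) := by
      intro a b
      obtain ⟨p⟩ := e₂.1.preconnected a b
      induction p with
      | nil => exact .refl _
      | cons h _ ih => exact (h.2.elim (arc _ _) fun h => (arc _ _ h).symm).trans ih
    have h2 : ∀ w, U.Reachable (.inl x₁) w := by
      rintro (a | b)
      · exact r1 a
      · exact hx.trans (r2 _ _)
    exact (connected_iff _).2 ⟨fun a b => (h2 a).symm.trans (h2 b), ⟨.inl x₁⟩⟩
  · have s₁ : ∑ v, indegree (glue D₁ x₁ D₂ x₂) (.inl v) = ∑ v, indegree D₁ v + 1 := by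
      have : ∀ v, indegree (glue D₁ x₁ D₂ x₂) (.inl v) =
          indegree D₁ v + if v = x₁ then 1 else 0 := by
        intro v
        by_cases hv : v = x₁
        · subst hv; rw [glue_indegree_inl_self, hi₂, if_pos rfl]
        · rw [glue_indegree_inl hv, if_neg hv, add_zero]
      simp [this, Finset.sum_add_distrib]
    have s₂ : ∀ v, indegree (glue D₁ x₁ D₂ x₂) (.inr v) = indegree D₂ v := by
      intro v
      by_cases hv : v = x₂
      · subst hv; rw [glue_indegree_inr_self, hi₂]
      · exact glue_indegree_inr hv
    simp only [Fintype.sum_sum_type, s₁, s₂, Fintype.card_sum, ← e₁.2, ← e₂.2]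
    omega

lemma isArborealNetwork_glue (hN₁ : IsArborealNetwork D₁) (hN₂ : IsArborealNetwork D₂)
    (h₁ : outdegree D₁ x₁ = 0) (h₂ : outdegree D₂ x₂ = 0) :
    IsArborealNetwork (glue D₁ x₁ D₂ x₂) := by
  have := hN₁.finite
  have := hN₂.finite
  have hs₁ := outdegree_eq_zero.1 h₁
  have hs₂ := outdegree_eq_zero.1 h₂
  have hi₁ := hN₁.indegree_of_leaf _ h₁
  have hi₂ := hN₂.indegree_of_leaf _ h₂
  have ht : (glue D₁ x₁ D₂ x₂).toSimpleGraphInclusive.IsTree :=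
    isTree_glue hs₁ hs₂ hN₁.acyclic hN₂.acyclic hi₂ hN₁.isTree hN₂.isTree
  have inr_in : ∀ v, indegree (glue D₁ x₁ D₂ x₂) (.inr v) = indegree D₂ v := by
    intro v
    by_cases hv : v = x₂
    · subst hv; rw [glue_indegree_inr_self, hi₂]
    · exact glue_indegree_inr hv
  refine ⟨⟨inferInstance, ht.connected, isAcyclic_glue hs₁ hs₂ hN₁.acyclic hN₂.acyclic,
    ?_, ?_, ?_⟩, ht⟩
  · rintro (v | v)
    · by_cases hv : v = x₁
      · subst hv; simp [glue_indegree_inl_self, hi₁, hi₂]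
      · rw [glue_indegree_inl hv, glue_outdegree_inl hv]; exact hN₁.two_le_outdegree_of_root v
    · rw [inr_in, glue_outdegree_inr]; exact hN₂.two_le_outdegree_of_root v
  · rintro (v | v)
    · by_cases hv : v = x₁
      · subst hv; simp [glue_outdegree_inl_self hs₁]
      · rw [glue_indegree_inl hv, glue_outdegree_inl hv]; exact hN₁.indegree_of_leaf v
    · rw [inr_in, glue_outdegree_inr]; exact hN₂.indegree_of_leaf v
  · rintro (v | v)
    · by_cases hv : v = x₁
      · subst hv; simp [glue_indegree_inl_self, hi₁, hi₂]
      · rw [glue_indegree_inl hv, glue_outdegree_inl hv]; exact hN₁.no_subdivision v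
    · rw [inr_in, glue_outdegree_inr]; exact hN₂.no_subdivision v

end Glue
end Construction

/-! ### Existence of a network -/

section Existence

variable {V W X : Type*}

/-- Gluing the representations of two parts at the leaves of a cut vertex. -/
lemma Represents.exists_glue [Finite V] [Finite W] {G Gs : SimpleGraph X} (hle : G ≤ Gs) {s : X}
    {A B : Set X} (hcut : IsCut Gs s A B) {D₁ : Digraph V} {D₂ : Digraph W} {t₁ : V → Prop}
    {t₂ : W → Prop} {f₁ : A → V} {f₂ : B → W}
    (hA : Represents D₁ t₁ f₁ (G.comap (Subtype.val : A → X)) (Gs.comap (Subtype.val : A → X)))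
    (hB : Represents D₂ t₂ f₂ (G.comap (Subtype.val : B → X)) (Gs.comap (Subtype.val : B → X))) :
    ∃ (t : V ⊕ W → Prop) (f : X → V ⊕ W),
      Represents (glue D₁ (f₁ ⟨s, hcut.left⟩) D₂ (f₂ ⟨s, hcut.right⟩)) t f G Gs := by
  classical
  set x₁ : V := f₁ ⟨s, hcut.left⟩ with hx₁
  set x₂ : W := f₂ ⟨s, hcut.right⟩ with hx₂
  have hs₁ : ∀ c, ¬ D₁.Adj x₁ c := hA.sink _
  have hs₂ : ∀ c, ¬ D₂.Adj x₂ c := hB.sink _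
  have sh₁ := hA.share_adj
  have lca₁ := hA.lca_adj
  have sh₂ := hB.share_adj
  have lca₂ := hB.lca_adj
  simp only [comap_adj] at sh₁ lca₁ sh₂ lca₂
  have memA : ∀ z, z ∉ B → z ∈ A := fun z hz => (hcut.cover z).resolve_right hz
  let t : V ⊕ W → Prop := Sum.elim t₁ t₂
  let f : X → V ⊕ W := fun z =>
    if hz : z ∈ B then .inr (f₂ ⟨z, hz⟩) else .inl (f₁ ⟨z, memA z hz⟩)
  have fB : ∀ z (hz : z ∈ B), f z = .inr (f₂ ⟨z, hz⟩) := fun z hz => dif_pos hz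
  have fA : ∀ z (hz : z ∉ B), f z = .inl (f₁ ⟨z, memA z hz⟩) := fun z hz => dif_neg hz
  have ne₁ : ∀ z (hz : z ∉ B), f₁ ⟨z, memA z hz⟩ ≠ x₁ := by
    intro z hz e
    have : z = s := congrArg Subtype.val (hA.injective e)
    exact hz (this ▸ hcut.right)
  -- the ancestors of a leaf of `D₁` other than `x₁` all lie in `D₁`
  have anc₁ : ∀ z (hz : z ∉ B) w,
      ¬ IsAncestor (glue D₁ x₁ D₂ x₂) (.inr w) (.inl (f₁ ⟨z, memA z hz⟩)) := by
    intro z hz w h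
    exact ne₁ z hz (glue_isAncestor_of_inr hs₁ h).2
  let H₁ := shareGraph (glue D₁ x₁ D₂ x₂)
  let H₂ := lcaGraph (glue D₁ x₁ D₂ x₂) t
  have hBB : ∀ y z, y ∈ B → z ∈ B → y ≠ z →
      (H₁.Adj (f y) (f z) ↔ Gs.Adj y z) ∧ (H₂.Adj (f y) (f z) ↔ G.Adj y z) := by
    intro y z hy hz hyz
    have hne : f₂ ⟨y, hy⟩ ≠ f₂ ⟨z, hz⟩ := fun e => hyz (congrArg Subtype.val (hB.injective e))
    rw [fB y hy, fB z hz, sh₂ ⟨y, hy⟩ ⟨z, hz⟩, lca₂ ⟨y, hy⟩ ⟨z, hz⟩]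
    refine adj_iff_of_common Sum.inr hne (Sum.inr_injective.ne hne) ?_ ?_ (fun _ _ => Iff.rfl)
    · rintro (a | a)
      · simp only [glue_isAncestor_inl_inr hs₂, reduceCtorEq, false_and, exists_false,
          iff_false]
        rintro ⟨⟨-, h1⟩, -, h2⟩
        exact hne (h1.trans h2.symm)
      · simp [glue_isAncestor_inr hs₁]
    · rintro a c - ⟨h1, h2⟩
      refine ⟨fun h => h.1, fun h => ⟨h, ?_⟩⟩
      rintro rfl
      exact hne ((eq_of_isAncestor_of_sink hs₂ h1).trans
        (eq_of_isAncestor_of_sink hs₂ h2).symm)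
  have hAA : ∀ y z, y ∉ B → z ∉ B → y ≠ z →
      (H₁.Adj (f y) (f z) ↔ Gs.Adj y z) ∧ (H₂.Adj (f y) (f z) ↔ G.Adj y z) := by
    intro y z hy hz hyz
    have hne : f₁ ⟨y, memA y hy⟩ ≠ f₁ ⟨z, memA z hz⟩ :=
      fun e => hyz (congrArg Subtype.val (hA.injective e))
    rw [fA y hy, fA z hz, sh₁ ⟨y, memA y hy⟩ ⟨z, memA z hz⟩, lca₁ ⟨y, memA y hy⟩ ⟨z, memA z hz⟩]
    refine adj_iff_of_common Sum.inl hne (Sum.inl_injective.ne hne) ?_ (fun _ _ _ _ => Iff.rfl)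
      (fun _ _ => Iff.rfl)
    rintro (a | a)
    · simp [glue_isAncestor_inl hs₂]
    · simp [anc₁ y hy a]
  have hAB : ∀ y z, y ∉ B → z ∈ B →
      (H₁.Adj (f y) (f z) ↔ Gs.Adj y z) ∧ (H₂.Adj (f y) (f z) ↔ G.Adj y z) := by
    intro y z hy hz
    by_cases hzs : z = s
    · subst hzs
      rw [fA y hy, fB z hz, sh₁ ⟨y, memA y hy⟩ ⟨z, hcut.left⟩, lca₁ ⟨y, memA y hy⟩ ⟨z, hcut.left⟩]
      refine adj_iff_of_common Sum.inl (ne₁ y hy) (by simp) ?_ (fun _ _ _ _ => Iff.rfl)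
        (fun _ _ => Iff.rfl)
      rintro (a | a)
      · simp [glue_isAncestor_inl hs₂, glue_isAncestor_inl_inr hs₂, ← hx₂, ← hx₁]
      · simp [anc₁ y hy a]
    · have hn : ¬ Gs.Adj y z :=
        hcut.not_adj y z (memA y hy) hz (by rintro rfl; exact hy hcut.right) hzs
      have hn' : ¬ H₁.Adj (f y) (f z) := by
        rw [fA y hy, fB z hz]
        rintro ⟨-, (a | a), h1, h2⟩
        · have := ((glue_isAncestor_inl_inr hs₂).1 h2).2
          exact hzs (congrArg Subtype.val (hB.injective this))
        · exact anc₁ y hy a h1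
      exact ⟨iff_of_false hn' hn,
        iff_of_false (fun h => hn' (lcaGraph_le_shareGraph _ _ h)) fun h => hn (hle h)⟩
  have all : ∀ y z, y ≠ z →
      (H₁.Adj (f y) (f z) ↔ Gs.Adj y z) ∧ (H₂.Adj (f y) (f z) ↔ G.Adj y z) := by
    intro y z hyz
    by_cases hy : y ∈ B <;> by_cases hz : z ∈ B
    · exact hBB y z hy hz hyz
    · rw [H₁.adj_comm, H₂.adj_comm, G.adj_comm, Gs.adj_comm]
      exact hAB z y hz hy
    · exact hAB y z hy hz
    · exact hAA y z hy hz hyz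
  refine ⟨t, f, ?_, ?_, ?_, ?_⟩
  · intro y z hyz
    by_cases hy : y ∈ B <;> by_cases hz : z ∈ B
    · rw [fB y hy, fB z hz] at hyz
      exact congrArg Subtype.val (hB.injective (Sum.inr_injective hyz))
    · rw [fB y hy, fA z hz] at hyz; cases hyz
    · rw [fA y hy, fB z hz] at hyz; cases hyz
    · rw [fA y hy, fA z hz] at hyz
      exact congrArg Subtype.val (hA.injective (Sum.inl_injective hyz))
  · rintro (v | v)
    · by_cases hv : v = x₁
      · subst hv
        rw [glue_outdegree_inl_self hs₁]
        refine iff_of_false one_ne_zero ?_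
        rintro ⟨z, hz⟩
        by_cases hzB : z ∈ B
        · rw [fB z hzB] at hz; cases hz
        · rw [fA z hzB] at hz
          exact ne₁ z hzB (Sum.inl_injective hz)
      · rw [glue_outdegree_inl hv, hA.leaf_iff]
        constructor
        · rintro ⟨⟨z, hz⟩, rfl⟩
          have hzB : z ∉ B := by
            intro hzB
            obtain rfl := hcut.inter z hz hzB
            exact hv rfl
          exact ⟨z, fA z hzB⟩
        · rintro ⟨z, hz⟩
          by_cases hzB : z ∈ B
          · rw [fB z hzB] at hz; cases hz
          · rw [fA z hzB] at hz
            exact ⟨_, Sum.inl_injective hz⟩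
    · rw [glue_outdegree_inr, hB.leaf_iff]
      constructor
      · rintro ⟨⟨z, hz⟩, rfl⟩
        exact ⟨z, fB z hz⟩
      · rintro ⟨z, hz⟩
        by_cases hzB : z ∈ B
        · rw [fB z hzB] at hz
          exact ⟨_, Sum.inr_injective hz⟩
        · rw [fA z hzB] at hz; cases hz
  · ext y z
    by_cases hyz : y = z
    · subst hyz; simp
    · exact (all y z hyz).1.symm
  · ext y z
    by_cases hyz : y = z
    · subst hyz; simp
    · exact (all y z hyz).2.symm

/-- A pair of graphs on at least two vertices satisfying the conditions is represented by an
arboreal network: joint twins become the leaves of a cherry, and at a cut vertex two networks are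
glued. -/
theorem Good.exists_represents {X : Type u} [Finite X] [Nontrivial X] {G Gs : SimpleGraph X}
    (h : Good G Gs) :
    ∃ (V : Type u) (D : Digraph V) (t : V → Prop) (f : X → V),
      IsArborealNetwork D ∧ Represents D t f G Gs := by
  induction hn : Nat.card X using Nat.strong_induction_on generalizing X with
  | _ n ih =>
    have hsub : ∀ S : Set X, (∃ v, v ∉ S) → Nontrivial S →
        (Gs.comap (Subtype.val : S → X)).Connected →
        ∃ (V : Type u) (D : Digraph V) (t : V → Prop) (f : S → V), IsArborealNetwork D ∧
          Represents D t f (G.comap (Subtype.val : S → X)) (Gs.comap (Subtype.val : S → X)) := by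
      rintro S ⟨v, hv⟩ hS hc
      exact ih _ (hn ▸ Finite.card_subtype_lt hv) (h.comap Subtype.val_injective hc) rfl
    rcases h.jointTwins_or_isCut with ⟨x, v, hj⟩ | ⟨s, A, B, hcut, ⟨a, ha, has⟩, ⟨b, hb, hbs⟩⟩
    · rcases subsingleton_or_nontrivial {z | z ≠ v} with hS | hS
      · -- the whole network is a single cherry
        have hac : IsAcyclic (⊥ : Digraph PUnit.{u + 1}) := by
          intro w hw
          obtain ⟨_, h1, -⟩ := Relation.TransGen.head'_iff.1 hw
          exact h1
        have hrep : Represents (⊥ : Digraph PUnit.{u + 1}) (fun _ => False)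
            (fun _ : {z | z ≠ v} => PUnit.unit) (G.comap Subtype.val)
            (Gs.comap Subtype.val) := by
          refine ⟨fun _ _ _ => Subsingleton.elim _ _,
            fun w => iff_of_true (outdegree_eq_zero.2 fun _ h => h) ⟨⟨x, hj.adj.ne⟩, rfl⟩, ?_, ?_⟩
          all_goals
            ext y z
            rw [Subsingleton.elim y z]
            simp
        obtain ⟨t', f', h'⟩ := hrep.exists_cherry hj
        exact ⟨_, _, t', f', isArborealNetwork_cherry hac IsTree.of_subsingleton (fun _ h => h)
          (fun w hw => absurd rfl hw) (fun w hw => absurd rfl hw) (fun w hw => absurd rfl hw), h'⟩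
      · obtain ⟨V, D, t, f, hN, hr⟩ := hsub {z | z ≠ v} ⟨v, fun h => h rfl⟩ hS
          (hj.connected_compl h.conn).1
        have := hN.finite
        obtain ⟨t', f', h'⟩ := hr.exists_cherry hj
        exact ⟨_, _, t', f', isArborealNetwork_cherry hN.acyclic hN.isTree (hr.sink _)
          (fun w _ => hN.two_le_outdegree_of_root w) (fun w _ => hN.indegree_of_leaf w)
          (fun w _ => hN.no_subdivision w), h'⟩
    · obtain ⟨V₁, D₁, t₁, f₁, hN₁, hr₁⟩ := hsub A ⟨b, fun hbA => hbs (hcut.inter b hbA hb)⟩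
        ⟨⟨a, ha⟩, ⟨s, hcut.left⟩, fun e => has (congrArg Subtype.val e)⟩
        (hcut.connected_left h.conn).1
      obtain ⟨V₂, D₂, t₂, f₂, hN₂, hr₂⟩ := hsub B ⟨a, fun haB => has (hcut.inter a ha haB)⟩
        ⟨⟨b, hb⟩, ⟨s, hcut.right⟩, fun e => hbs (congrArg Subtype.val e)⟩
        (hcut.symm.connected_left h.conn).1
      have := hN₁.finite
      have := hN₂.finite
      obtain ⟨t', f', h'⟩ := Represents.exists_glue h.le hcut hr₁ hr₂
      exact ⟨_, _, t', f', isArborealNetwork_glue hN₁ hN₂ ((hr₁.leaf_iff _).2 ⟨_, rfl⟩)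
        ((hr₂.leaf_iff _).2 ⟨_, rfl⟩), h'⟩

end Existence

/-! ### Translation to labelled arboreal networks -/

section Translation

variable {X V : Type u} {G Gs : SimpleGraph X}

/-- In a connected graph Ptolemy's inequality for distinct vertices implies it for all
quadruples. -/
lemma IsPtolemaic.forall_of_connected (h : IsPtolemaic Gs) (hc : Gs.Connected) (x y z t : X) :
    Gs.dist x z * Gs.dist y t ≤ Gs.dist x y * Gs.dist z t + Gs.dist x t * Gs.dist y z := by
  by_cases hd : x ≠ y ∧ x ≠ z ∧ x ≠ t ∧ y ≠ z ∧ y ≠ t ∧ z ≠ t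
  · obtain ⟨h1, h2, h3, h4, h5, h6⟩ := hd
    refine h x y z t ?_
    simp [h1, h2, h3, h4, h5, h6, hc.preconnected _ _]
  · have s := fun a b => dist_comm (G := Gs) (u := a) (v := b)
    by_cases h1 : x = y
    · subst h1; simp [mul_comm]
    by_cases h2 : x = z
    · subst h2; simp
    by_cases h3 : x = t
    · subst h3; rw [s y x, s z x]; simp [mul_comm]
    by_cases h4 : y = z
    · subst h4; simp
    by_cases h5 : y = t
    · subst h5; simp
    by_cases h6 : z = t
    · subst h6; simp
    tauto

/-- The elementwise conditions are equivalent to (E1), (E2), (E3). -/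
lemma good_iff (hle : G ≤ Gs) :
    Good G Gs ↔ (Gs.Connected ∧ IsPtolemaic Gs) ∧
      (¬ ∃ f : pathGraph 4 ↪g G, Gs.IsClique (Set.range f)) ∧
      (¬ ∃ x y z w : X, IsAsymmetricDiamond G Gs x y z w) := by
  constructor
  · intro h
    refine ⟨⟨h.conn, fun x y z t _ => h.ptolemy x y z t⟩, ?_, ?_⟩
    · rintro ⟨f, hf⟩
      have hadj : ∀ i j, G.Adj (f i) (f j) ↔ (pathGraph 4).Adj i j := fun i j => f.map_adj_iff
      have hcl : ∀ i j, i ≠ j → Gs.Adj (f i) (f j) := fun i j hij =>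
        hf ⟨i, rfl⟩ ⟨j, rfl⟩ (f.injective.ne hij)
      refine h.noP4 (f 0) (f 1) (f 2) (f 3) ?_ ?_ ?_ ?_ ?_ ?_ (hcl _ _ ?_) (hcl _ _ ?_)
        (hcl _ _ ?_) <;> simp [hadj, pathGraph_adj]
    · rintro ⟨x, y, z, w, hnd, ⟨h1, h2, h3, h4, h5, h6⟩, h7, h8⟩
      simp only [List.nodup_cons, List.mem_cons, List.not_mem_nil, or_false, not_or] at hnd
      exact h8 (h.noDiamond x y z w h1 h2 h3 h4 h5 hnd.2.2.1 h6 h7)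
  · rintro ⟨⟨hc, hp⟩, h2, h3⟩
    refine ⟨hle, hc, hp.forall_of_connected hc, ?_, ?_⟩
    · intro a b c d e1 e2 e3 n1 n2 n3 g1 g2 g3
      have s := fun p q => G.adj_comm p q
      have d1 := e1.ne
      have d2 := e2.ne
      have d3 := e3.ne
      have d4 := g1.ne
      have d5 := g2.ne
      have d6 := g3.ne
      refine h2 ⟨⟨⟨![a, b, c, d], ?_⟩, ?_⟩, ?_⟩
      · intro i j hij
        fin_cases i <;> fin_cases j <;> simp_all
      · intro i j
        change G.Adj (![a, b, c, d] i) (![a, b, c, d] j) ↔ _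
        fin_cases i <;> fin_cases j <;> simp_all [pathGraph_adj]
      · rintro _ ⟨i, rfl⟩ _ ⟨j, rfl⟩ hij
        change Gs.Adj (![a, b, c, d] i) (![a, b, c, d] j)
        have k1 := hle e1
        have k2 := hle e2
        have k3 := hle e3
        have s' := fun p q => Gs.adj_comm p q
        fin_cases i <;> fin_cases j <;> simp_all
    · intro x y z w h1 h2 h4 h5 h6 hne h7 h8
      by_contra h9
      refine h3 ⟨x, y, z, w, ?_, ⟨h1, h2, h4, h5, h6, h7⟩, h8, h9⟩
      simp [h1.ne, h2.ne, h4.ne, h5.ne, h6.ne, hne]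

/-- A least common ancestor of two distinct leaves is branching. -/
lemma two_le_outdegree_of_isLCA {D : Digraph V} [Finite V] {a x y : V} (hxy : x ≠ y)
    (hx : outdegree D x = 0) (hy : outdegree D y = 0) (h : IsLCA D a x y) :
    2 ≤ outdegree D a := by
  obtain ⟨⟨h1, h2⟩, h3⟩ := h
  rcases Relation.ReflTransGen.cases_head h1 with rfl | ⟨c, hc, hcx⟩
  · exact absurd (eq_of_isAncestor_of_sink (outdegree_eq_zero.1 hx) h2).symm hxy
  rcases Relation.ReflTransGen.cases_head h2 with rfl | ⟨d, hd, hdy⟩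
  · exact absurd (eq_of_isAncestor_of_sink (outdegree_eq_zero.1 hy) h1) hxy
  have hcd : c ≠ d := by rintro rfl; exact h3 c hc ⟨hcx, hdy⟩
  have : 1 < {c | D.Adj a c}.ncard := (Set.one_lt_ncard (Set.toFinite _)).2 ⟨c, hc, d, hd, hcd⟩
  exact this

lemma sharedAncestryGraph_eq (D : Digraph V) :
    sharedAncestryGraph D = (shareGraph D).comap Subtype.val := by
  ext x y
  exact and_congr_left fun _ => Subtype.val_injective.ne_iff.symm

lemma explainedGraph_eq (N : LabelledArborealNetwork V) :
    N.explainedGraph = (lcaGraph N.net fun v => ∃ h : 2 ≤ outdegree N.net v,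
      N.label ⟨v, h⟩ = 1).comap Subtype.val := by
  ext x y
  constructor
  · rintro ⟨hne, -, ⟨a, ha⟩, h1, h2⟩
    exact ⟨Subtype.val_injective.ne hne, a, h1, ha, h2⟩
  · rintro ⟨hne, a, h1, ha, h2⟩
    exact ⟨fun e => hne (congrArg _ e), ⟨a, h1.1⟩, ⟨a, ha⟩, h1, h2⟩

lemma connected_shareGraph {D : Digraph V} (h : D.toSimpleGraphInclusive.Connected) :
    (shareGraph D).Connected := by
  refine h.mono ?_
  rintro a b ⟨hne, hab | hab⟩
  · exact ⟨hne, a, .refl, .single hab⟩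
  · exact ⟨hne, b, .single hab, .refl⟩

/-- An arboreal network has at least two leaves: it has one arc less than it has vertices, but a
root has two children and every vertex that is not a leaf has at least one. -/
lemma IsArborealNetwork.nontrivial_leaf {D : Digraph V} (h : IsArborealNetwork D) :
    Nontrivial (Leaf D) := by
  classical
  have := h.finite
  have := Fintype.ofFinite V
  have := h.connected.nonempty
  -- reversing all arcs turns outdegrees into indegrees
  let R : Digraph V := ⟨fun a b => D.Adj b a⟩
  have hac : IsAcyclic R := fun v hv => h.acyclic v (Relation.transGen_swap.1 hv)
  have hR : R.toSimpleGraphInclusive = D.toSimpleGraphInclusive := by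
    ext a b
    exact and_congr_right fun _ => or_comm
  have hsum : ∑ v, outdegree D v + 1 = Fintype.card V :=
    ((isTree_iff_sum_indegree hac).1 (hR ▸ h.isTree)).2
  obtain ⟨r, hr⟩ := exists_sink hac
  have hr2 : 2 ≤ outdegree D r :=
    h.two_le_outdegree_of_root r (outdegree_eq_zero (D := R).2 hr)
  by_contra hL
  rw [not_nontrivial_iff_subsingleton] at hL
  have hcard : (Finset.univ.filter fun v => outdegree D v = 0).card ≤ 1 := by
    rw [Finset.card_le_one]
    intro a ha b hb
    rw [Finset.mem_filter] at ha hb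
    exact congrArg Subtype.val (Subsingleton.elim (⟨a, ha.2⟩ : Leaf D) ⟨b, hb.2⟩)
  have hle : ∑ v, (1 + if v = r then 1 else 0) ≤
      ∑ v, (outdegree D v + if outdegree D v = 0 then 1 else 0) := by
    refine Finset.sum_le_sum fun v _ => ?_
    by_cases hv : v = r
    · subst hv; simp; omega
    · split_ifs <;> omega
  have hone : (∑ v : V, if v = r then 1 else 0) = 1 := by simp
  have hV : ∑ _v : V, 1 = Fintype.card V := by simp
  rw [Finset.sum_add_distrib, Finset.sum_add_distrib, hone, hV, ← Finset.card_filter] at hle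
  omega

end Translation

end ArborealNet

theorem mainTheorem4 {X : Type u} [Finite X] (G Gs : SimpleGraph X)
    (hconn : G.Connected) (hexp : ArborealNet.ArborealExplainable G) (hsup : G ≤ Gs) :
    (∃ (V : Type u) (N : ArborealNet.LabelledArborealNetwork V)
        (e : X ≃ ArborealNet.Leaf N.net),
        N.Explains e G ∧ (ArborealNet.sharedAncestryGraph N.net).comap e = Gs) ↔
      ((Gs.Connected ∧ ArborealNet.IsPtolemaic Gs) ∧
        (¬ ∃ f : SimpleGraph.pathGraph 4 ↪g G, Gs.IsClique (Set.range f)) ∧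
        (¬ ∃ x y z w : X, ArborealNet.IsAsymmetricDiamond G Gs x y z w)) := by
  open ArborealNet in
  rw [← good_iff hsup]
  have hGs : Gs.Connected := hconn.mono hsup
  constructor
  · rintro ⟨V, N, e, hG, hA⟩
    have := N.arboreal.finite
    have hgood := good_lcaGraph_shareGraph N.net
      (fun v => ∃ h : 2 ≤ outdegree N.net v, N.label ⟨v, h⟩ = 1) N.arboreal.acyclic
      N.arboreal.isTree.isAcyclic (connected_shareGraph N.arboreal.connected)
    have e1 : Gs = (shareGraph N.net).comap fun x => (e x).1 := by
      rw [← hA, sharedAncestryGraph_eq]; rfl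
    have e2 : G = (lcaGraph N.net fun v => ∃ h : 2 ≤ outdegree N.net v,
        N.label ⟨v, h⟩ = 1).comap fun x => (e x).1 := by
      rw [← hG, explainedGraph_eq]; rfl
    have := hgood.comap (f := fun x => (e x).1) (Subtype.val_injective.comp e.injective)
      (e1 ▸ hGs)
    rwa [← e1, ← e2] at this
  · intro hgood
    have : Nontrivial X := by
      obtain ⟨V, N, e, -⟩ := hexp
      have := N.arboreal.nontrivial_leaf
      exact e.nontrivial
    obtain ⟨V, D, t, f, hN, hr⟩ := hgood.exists_represents
    classical
    have := hN.finite
    let N : LabelledArborealNetwork V := ⟨D, hN, fun v => if t v.1 then 1 else 0⟩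
    have hleaf : ∀ x, outdegree D (f x) = 0 := fun x => (hr.leaf_iff _).2 ⟨x, rfl⟩
    let e : X ≃ Leaf D := Equiv.ofBijective (fun x => ⟨f x, hleaf x⟩)
      ⟨fun x y h => hr.injective (congrArg Subtype.val h), fun v => by
        obtain ⟨x, hx⟩ := (hr.leaf_iff v.1).1 v.2
        exact ⟨x, Subtype.ext hx⟩⟩
    refine ⟨V, N, e, ?_, ?_⟩
    · unfold LabelledArborealNetwork.Explains
      rw [explainedGraph_eq, hr.lca]
      ext x y
      constructor
      · rintro ⟨hne, a, h1, ha, h2⟩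
        refine ⟨hne, a, h1, ?_⟩
        by_contra hta
        simp [N, hta] at h2
      · rintro ⟨hne, a, h1, hta⟩
        exact ⟨hne, a, h1, two_le_outdegree_of_isLCA hne (hleaf x) (hleaf y) h1, if_pos hta⟩
    · change (sharedAncestryGraph D).comap e = Gs
      rw [sharedAncestryGraph_eq, hr.share]
      rfl
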